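/- **Setting.** Let $G$ be an undirected graph on $n$ vertices that is initially empty and undergoes insertions of distinct edges. $G$ is augmented with a pseudo root $s$ joined to every vertex, and a DFS tree $T$ of the augmented graph rooted at $s$ is maintained; initially $T$ is the star at $s$. For a vertex $u$ let $T(u)$ be the subtree of $T$ rooted at $u$. The algorithm **SDFS3** treats the insertion of an edge $(x,y)$ as follows. If one of $x,y$ is an ancestor of the other in $T$, it only adds the edge to the graph. Otherwise let $u,v$ be the children of the lowest common ancestor of $x$ and $y$ with $x\in T(u)$ and $y\in T(v)$; say $T(v)$ has at most as many vertices as $T(u)$ (if the numbers are equal, either of the two may be chosen as the one to rebuild). SDFS3 finds the smaller subtree by a simultaneous traversal of $T(u)$ and $T(v)$, marks the vertices of $T(v)$ as unvisited, and replaces $T(v)$ by the tree of a depth-first traversal that starts from $y$ and is hung from $x$ by the edge $(x,y)$. The order in which a traversal scans adjacency lists is arbitrary. Time is the number of elementary steps: a constant per insertion, a constant per vertex of the rebuilt subtree, and a constant per entry of an adjacency list processed by a traversal. The algorithm **SDFS** recomputes a DFS tree of the whole augmented graph from scratch after every insertion. **Theorem.** There are absolute constants $a,b,c>0$ such that for all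 integers $n,m$ with $n\le m\le\binom n2$ there is a sequence of $m$ insertions of distinct edges on $n$ vertices, starting from the empty graph, on which SDFS3 takes $\Theta(m^2)$ total time to maintain the DFS tree: whichever order adjacency lists are scanned in and however ties are broken, its total time $t$ satisfies $a\,m^2\le t\le b\,m^2$. Consequently SDFS3 is no better than recomputation from scratch in the worst case: the total time of SDFS on any sequence of $m$ insertions of distinct edges on $n$ vertices is at most $c\,t$. -/

import Mathlib

/-! Incremental maintenance of a DFS tree of an undirected graph on the vertex set `V`, which is
augmented with a pseudo root `s` joined to every vertex.  The spanning tree rooted at `s` is kept as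
a parent map `V → Option V`, where `none` stands for the pseudo root `s`. -/

namespace IncDFS

variable {V : Type*}

/-- `u` is an ancestor of `v` (possibly `v` itself) in the tree with parent map `p`. -/
def IsAncestor (p : V → Option V) (u v : V) : Prop :=
  Relation.ReflTransGen (fun a b => p a = some b) v u

/-- The vertex set of the subtree `T(u)`. -/
def subtree (p : V → Option V) (u : V) : Set V := {v | IsAncestor p u v}

/-- `u` and `v` are the children of `LCA(x, y)` whose subtrees contain `x` and `y` respectively;
such `u`, `v` exist exactly if neither of `x`, `y` is an ancestor of the other. -/
def AreCandidates (p : V → Option V) (x y u v : V) : Prop :=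
  u ≠ v ∧ p u = p v ∧ x ∈ subtree p u ∧ y ∈ subtree p v

/-- `l` is an adjacency list of `v`: the neighbours of `v`, in some order. -/
def IsAdjList (G : SimpleGraph V) (v : V) (l : List V) : Prop :=
  l.Nodup ∧ ∀ w, w ∈ l ↔ G.Adj v w

/-- The graph `G` with the edge `e` inserted. -/
def addEdge (G : SimpleGraph V) (e : Sym2 V) : SimpleGraph V :=
  G ⊔ SimpleGraph.fromEdgeSet {e}

/-- The recursive depth-first traversal, with a step count.
`DFSScan G q l U p U' p' t`: at the vertex `q` (`none` is the pseudo root) the part `l` of the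
adjacency list of `q` is still to be scanned, `U` is the set of unvisited vertices and `p` the parent
map; after the scan these are `U'` and `p'`, and `t` steps were made.  Each entry of an adjacency
list that is processed is a step, and so is each visit of a vertex (which also accounts for the
edge between that vertex and the pseudo root).  The order of the adjacency lists is arbitrary. -/
inductive DFSScan [DecidableEq V] (G : SimpleGraph V) :
    Option V → List V → Set V → (V → Option V) → Set V → (V → Option V) → ℕ → Prop
  | nil (q : Option V) (U : Set V) (p : V → Option V) : DFSScan G q [] U p U p 0
  | visited (q : Option V) (w : V) (l : List V) (U U' : Set V) (p p' : V → Option V) (t : ℕ) :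
      w ∉ U →
      DFSScan G q l U p U' p' t →
      DFSScan G q (w :: l) U p U' p' (t + 1)
  | unvisited (q : Option V) (w : V) (l k : List V) (U U₁ U₂ : Set V)
      (p p₁ p₂ : V → Option V) (t₁ t₂ : ℕ) :
      w ∈ U →
      IsAdjList G w k →
      DFSScan G (some w) k (U \ {w}) (Function.update p w q) U₁ p₁ t₁ →
      DFSScan G q l U₁ p₁ U₂ p₂ t₂ →
      DFSScan G q (w :: l) U p U₂ p₂ (t₁ + t₂ + 2)

/-- One edge insertion of SDFS3: on the graph `G` with tree `p`, the insertion of the edge `e`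
may turn the tree into `p'` in `t` steps.  (The roles of the endpoints `x`, `y` of `e` are
interchangeable, so if the two candidate subtrees have equally many vertices, either may be
rebuilt.) -/
inductive SDFS3Insert [DecidableEq V] (G : SimpleGraph V) (p : V → Option V) :
    Sym2 V → (V → Option V) → ℕ → Prop
  /-- Back edge: only the graph is updated. -/
  | back (x y : V) : IsAncestor p x y → SDFS3Insert G p s(x, y) p 1
  /-- Cross edge, where the candidate subtree `T(v)` containing `y` is the smaller one.  Besides the
  constant cost of an insertion: simultaneous traversal of both candidate subtrees until the
  smaller one is exhausted (`2 * |T(v)|`), marking its vertices as unvisited (`|T(v)|`), and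
  the traversal of `T(v)` from `y`, hung from `x` by the edge `(x, y)` (`t`). -/
  | cross (x y u v : V) (U' : Set V) (p' : V → Option V) (t : ℕ) :
      ¬ IsAncestor p x y → ¬ IsAncestor p y x →
      AreCandidates p x y u v →
      (subtree p v).ncard ≤ (subtree p u).ncard →
      DFSScan (addEdge G s(x, y)) (some x) [y] (subtree p v) p U' p' t →
      SDFS3Insert G p s(x, y) p' (1 + 3 * (subtree p v).ncard + t)

/-- SDFS3 can process the edge insertions in the list, from graph `G` and tree `p`, in a total of
`t` steps. -/
inductive SDFS3Run [DecidableEq V] :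
    SimpleGraph V → (V → Option V) → List (Sym2 V) → ℕ → Prop
  | nil (G : SimpleGraph V) (p : V → Option V) : SDFS3Run G p [] 0
  | cons (G : SimpleGraph V) (p p' : V → Option V) (e : Sym2 V) (es : List (Sym2 V)) (t t' : ℕ) :
      SDFS3Insert G p e p' t →
      SDFS3Run (addEdge G e) p' es t' →
      SDFS3Run G p (e :: es) (t + t')

/-- `t` is a possible total time of SDFS3 on the insertion sequence `es`, starting from the empty
graph, whose tree is the star formed by the edges of the pseudo root.  Different possible times
come from the arbitrary order of adjacency lists and from ties between candidate subtrees. -/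
def SDFS3Takes [DecidableEq V] (es : List (Sym2 V)) (t : ℕ) : Prop :=
  SDFS3Run (⊥ : SimpleGraph V) (fun _ => none) es t

/-- SDFS, recomputation from scratch: after each insertion a DFS tree of the whole graph is
computed from the pseudo root, whose adjacency list consists of all the vertices. -/
inductive SDFSRun [DecidableEq V] : SimpleGraph V → List (Sym2 V) → ℕ → Prop
  | nil (G : SimpleGraph V) : SDFSRun G [] 0
  | cons (G : SimpleGraph V) (e : Sym2 V) (es : List (Sym2 V)) (l : List V) (U' : Set V)
      (p' : V → Option V) (t t' : ℕ) :
      l.Nodup → (∀ w, w ∈ l) →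
      DFSScan (addEdge G e) none l Set.univ (fun _ => none) U' p' t →
      SDFSRun (addEdge G e) es t' →
      SDFSRun G (e :: es) (1 + t + t')

/-- `t` is a possible total time of SDFS on the insertion sequence `es`, starting from the empty
graph. -/
def SDFSTakes [DecidableEq V] (es : List (Sym2 V)) (t : ℕ) : Prop :=
  SDFSRun (⊥ : SimpleGraph V) es t

/-- A sequence of `m` insertions of distinct (undirected, loopless) edges. -/
def IsInsertionSeq (m : ℕ) (es : List (Sym2 V)) : Prop :=
  es.length = m ∧ es.Nodup ∧ ∀ e ∈ es, ¬ e.IsDiag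

end IncDFS

/-! The upper bounds hold because one insertion costs O(n + m) in either algorithm, a traversal
processing each adjacency list at most once, and n ≤ m. For the lower bound let N be of order √m. It
suffices to force N^4 steps by O(N^2) insertions on O(N) vertices, since edges appended afterwards
only add time.

The expensive step is to rehang a clique `K` of order N vertices: a single edge makes the traversal
scan order N^2 list entries. An edge `(b, P 0)` pulls a path `P` below `b` and so orients it from `P
0`. The edges `(P i, d)` with a fixed `d ∈ K` drag the clique down the path vertex by vertex, as
long as the rest of the path outweighs the clique. An edge `(c, d)`, where `c` carries a set `W` of
leaves heavier than `P` and `K` together, then forces the tree of `P` and `K` to be rebuilt from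
`d`. All edges between path and clique end in `d`, so below `d` the path and `K.erase d` are
separate components and hang there side by side, as at the beginning. The leaves are moved by one
edge each to a new pair `b'`, `c'` taken from `W`, which restores the weight beside `P` and `K`.
Such a phase (`exists_phase`) has O(N) insertions, takes order N^3 steps, and uses up one clique
vertex and two leaves, so it can be repeated N times (`exists_phases`).

Scan orders and ties have no influence. The size comparisons that matter are strict, so
`SDFS3Insert.rehung` says which subtree moves. The tree remains a DFS forest
(`IsDFSForest.rebuild`), and in any DFS forest a component of the graph below `z` is the subtree of
a child of `z` (`IsDFSForest.hangs_of_component`). The shape of the tree inside the clique is never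
used, and on the path it is forced (`IsDFSForest.parent_path`). -/

namespace IncDFS

variable {V : Type*} {p p' : V → Option V} {G : SimpleGraph V} {S : Set V}

/-! ### Ancestors in a parent map -/

/-- Every vertex descends from a child of the pseudo root. -/
def IsRooted (p : V → Option V) : Prop := ∀ v, ∃ r, p r = none ∧ IsAncestor p r v

theorem IsAncestor.refl (p : V → Option V) (v : V) : IsAncestor p v v := Relation.ReflTransGen.refl

theorem IsAncestor.trans {a b c : V} (h : IsAncestor p a b) (h' : IsAncestor p b c) :
    IsAncestor p a c :=
  Relation.ReflTransGen.trans h' h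

theorem IsAncestor.of_parent {a b : V} (h : p b = some a) : IsAncestor p a b :=
  Relation.ReflTransGen.single h

theorem IsAncestor.eq_or_parent {a b : V} (h : IsAncestor p a b) :
    b = a ∨ ∃ c, p b = some c ∧ IsAncestor p a c :=
  Relation.ReflTransGen.cases_head h

theorem IsAncestor.comparable {a b w : V} (ha : IsAncestor p a w) (hb : IsAncestor p b w) :
    IsAncestor p a b ∨ IsAncestor p b a := by
  refine (Relation.ReflTransGen.total_of_right_unique ?_ ha hb).symm
  intro x y z hxy hxz
  exact Option.some.inj (hxy.symm.trans hxz)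

/-- Parents are unique, so accessibility passes down the path from a root to each vertex. This
excludes cycles and permits induction towards the roots. -/
theorem IsRooted.wellFounded (h : IsRooted p) : WellFounded fun a b => p b = some a := by
  refine ⟨fun v => ?_⟩
  obtain ⟨r, hr, hv⟩ := h v
  induction hv using Relation.ReflTransGen.head_induction_on with
  | refl => exact ⟨_, fun a ha => by simp [hr] at ha⟩
  | head hab _ ih =>
    refine ⟨_, fun a ha => ?_⟩
    have : a = _ := Option.some.inj (ha.symm.trans hab)
    exact this ▸ ih

theorem IsRooted.antisymm (h : IsRooted p) {a b : V} (hab : IsAncestor p a b)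
    (hba : IsAncestor p b a) : a = b := by
  by_contra hne
  have h1 := (Relation.reflTransGen_iff_eq_or_transGen.1 hab).resolve_left hne
  have h2 := (Relation.reflTransGen_iff_eq_or_transGen.1 hba).resolve_left (Ne.symm hne)
  have h3 := h2.trans h1
  have wf := h.wellFounded.transGen
  exact wf.irrefl.irrefl a (Relation.transGen_swap.1 h3)

theorem IsRooted.parent_ne (h : IsRooted p) (a : V) : p a ≠ some a :=
  fun ha => h.wellFounded.irrefl.irrefl a ha

theorem IsRooted.not_isAncestor_parent (h : IsRooted p) {a b : V} (hb : p b = some a) :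
    ¬ IsAncestor p b a := fun h' =>
  h.parent_ne a (h.antisymm h' (.of_parent hb) ▸ hb)

theorem IsRooted.not_isAncestor_sibling (h : IsRooted p) {u v : V} (huv : u ≠ v)
    (hp : p u = p v) : ¬ IsAncestor p u v := by
  intro ha
  rcases ha.eq_or_parent with rfl | ⟨c, hc, hac⟩
  · exact huv rfl
  · exact h.not_isAncestor_parent (hp.trans hc) hac

theorem IsRooted.disjoint_siblings (h : IsRooted p) {u v : V} (huv : u ≠ v) (hp : p u = p v) :
    Disjoint (subtree p u) (subtree p v) := by
  rw [Set.disjoint_left]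
  intro x hu hv
  rcases IsAncestor.comparable hu hv with h' | h'
  · exact h.not_isAncestor_sibling huv hp h'
  · exact h.not_isAncestor_sibling huv.symm hp.symm h'

/-- Both `u` and `u₀` are ancestors of `x`, hence comparable. If `u` were a proper ancestor of `u₀`,
the common parent of `u₀` and `v₀` would lie in `T(u)`, and so would `y`, which is in the disjoint
`T(v)`. -/
theorem IsRooted.siblings_unique (h : IsRooted p) {x y u v u₀ v₀ : V}
    (h₁ : AreCandidates p x y u v) (h₀ : AreCandidates p x y u₀ v₀) : u = u₀ ∧ v = v₀ := by
  obtain ⟨n₁, e₁, x₁, y₁⟩ := h₁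
  obtain ⟨n₀, e₀, x₀, y₀⟩ := h₀
  have key : ∀ {u v u₀ v₀ x y : V}, u ≠ v → p u = p v → u₀ ≠ v₀ → p u₀ = p v₀ →
      IsAncestor p u x → IsAncestor p v y → IsAncestor p u₀ x → IsAncestor p v₀ y →
      IsAncestor p u u₀ → u = u₀ := by
    intro u v u₀ v₀ x y n₁ e₁ n₀ e₀ x₁ y₁ x₀ y₀ hu
    rcases hu.eq_or_parent with rfl | ⟨c, hc, hac⟩
    · rfl
    · have h1 : IsAncestor p u v₀ := hac.trans (.of_parent (e₀ ▸ hc))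
      exact (Set.disjoint_left.1 (h.disjoint_siblings n₁ e₁) (h1.trans y₀) y₁).elim
  constructor
  · rcases IsAncestor.comparable x₁ x₀ with hu | hu
    · exact key n₁ e₁ n₀ e₀ x₁ y₁ x₀ y₀ hu
    · exact (key n₀ e₀ n₁ e₁ x₀ y₀ x₁ y₁ hu).symm
  · rcases IsAncestor.comparable y₁ y₀ with hu | hu
    · exact key n₁.symm e₁.symm n₀.symm e₀.symm y₁ x₁ y₀ x₀ hu
    · exact (key n₀.symm e₀.symm n₁.symm e₁.symm y₀ x₀ y₁ x₁ hu).symm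

theorem AreCandidates.symm {x y u v : V} (h : AreCandidates p x y u v) :
    AreCandidates p y x v u :=
  ⟨h.1.symm, h.2.1.symm, h.2.2.2, h.2.2.1⟩

theorem IsRooted.not_isAncestor_of_candidates (h : IsRooted p) {x y u v : V}
    (hc : AreCandidates p x y u v) : ¬ IsAncestor p x y := fun hxy =>
  Set.disjoint_left.1 (h.disjoint_siblings hc.1 hc.2.1) (IsAncestor.trans hc.2.2.1 hxy) hc.2.2.2

theorem IsRooted.exists_candidates (h : IsRooted p) {x y : V} (hxy : ¬ IsAncestor p x y)
    (hyx : ¬ IsAncestor p y x) : ∃ u v, AreCandidates p x y u v := by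
  -- climb from `x` to the last vertex that is not an ancestor of `y`
  have key : ∀ x, ¬ IsAncestor p x y → ∃ u, IsAncestor p u x ∧ ¬ IsAncestor p u y ∧
      ∀ a, p u = some a → IsAncestor p a y := by
    intro x
    induction x using h.wellFounded.induction with
    | _ x ih =>
      intro hx
      by_cases hall : ∀ a, p x = some a → IsAncestor p a y
      · exact ⟨x, .refl p x, hx, hall⟩
      · push Not at hall
        obtain ⟨a, ha, hay⟩ := hall
        obtain ⟨u, hu, h1, h2⟩ := ih a ha hay
        exact ⟨u, hu.trans (.of_parent ha), h1, h2⟩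
  obtain ⟨u, hux, huy, hu⟩ := key x hxy
  -- Climbing from `y` reaches a child of the parent of `u`, since that parent is a proper ancestor
  -- of `y` (or is the pseudo root).
  have key2 : ∀ y, (∀ a, p u = some a → IsAncestor p a y) → ¬ IsAncestor p u y →
      (∀ a, p u = some a → a ≠ y) →
      ∃ v, p u = p v ∧ IsAncestor p v y := by
    intro y
    induction y using h.wellFounded.induction with
    | _ y ih =>
      intro h1 h2 h3
      cases hpy : p y with
      | none =>
        cases hpu : p u with
        | none => exact ⟨y, hpy.symm, .refl p y⟩
        | some a =>
          rcases (h1 a hpu).eq_or_parent with h4 | ⟨c, hc, _⟩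
          · exact (h3 a hpu h4.symm).elim
          · simp [hpy] at hc
      | some c =>
        by_cases hpu : p u = some c
        · exact ⟨y, hpu.trans hpy.symm, .refl p y⟩
        · obtain ⟨v, hv, hvc⟩ := ih c hpy
            (fun a ha => by
              rcases (h1 a ha).eq_or_parent with h4 | ⟨c', hc', h5⟩
              · exact (h3 a ha h4.symm).elim
              · rw [hpy] at hc'; cases hc'; exact h5)
            (fun h5 => h2 (h5.trans (.of_parent hpy)))
            (fun a ha hac => hpu (hac ▸ ha))
          exact ⟨v, hv, hvc.trans (.of_parent hpy)⟩
  obtain ⟨v, hv, hvy⟩ := key2 y hu huy fun a ha hay =>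
    hyx (hay ▸ (IsAncestor.of_parent ha).trans hux)
  exact ⟨u, v, fun huv => huy (huv ▸ hvy), hv, hux, hvy⟩

/-- `a` is an ancestor of `b` by a path of parents within `S`. -/
def IsAncestorIn (p : V → Option V) (S : Set V) (a b : V) : Prop :=
  Relation.ReflTransGen (fun u v => p u = some v ∧ u ∈ S ∧ v ∈ S) b a

theorem IsAncestorIn.isAncestor {a b : V} (h : IsAncestorIn p S a b) : IsAncestor p a b :=
  Relation.ReflTransGen.mono (fun _ _ h => h.1) _ _ h

theorem IsAncestorIn.congr {S' : Set V} {a b : V} (h : IsAncestorIn p S a b) (hS : S ⊆ S')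
    (hp : ∀ v ∈ S, p' v = p v) : IsAncestorIn p' S' a b :=
  Relation.ReflTransGen.mono (fun _ _ h => ⟨(hp _ h.2.1).trans h.1, hS h.2.1, hS h.2.2⟩) _ _ h

/-! ### The outcome of a depth-first scan -/

/-- What a depth-first scan guarantees, whichever order is used: `U \ U'` is the set of visited
vertices. -/
structure ScanSpec (G : SimpleGraph V) (q : Option V) (l : List V) (U : Set V)
    (p : V → Option V) (U' : Set V) (p' : V → Option V) : Prop where
  sub : U' ⊆ U
  off : ∀ v, v ∉ U \ U' → p' v = p v
  anc : ∀ w ∈ U \ U', ∃ c ∈ U \ U', p' c = q ∧ IsAncestorIn p' (U \ U') c w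
  list : ∀ w ∈ l, w ∉ U'
  closed : ∀ w ∈ U \ U', ∀ v, G.Adj w v → v ∉ U'
  parent : ∀ a ∈ U \ U', (p' a = q ∧ a ∈ l) ∨ ∃ v ∈ U \ U', p' a = some v ∧ G.Adj v a
  comp : ∀ a ∈ U \ U', ∀ b ∈ U \ U', G.Adj a b →
    IsAncestorIn p' (U \ U') a b ∨ IsAncestorIn p' (U \ U') b a

/-- Ancestry is recorded within the visited set, where later calls do not change the parent map;
this lets the two recursive calls be combined. -/
theorem DFSScan.spec [DecidableEq V] {q : Option V} {l : List V} {U U' : Set V} {t : ℕ}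
    (h : DFSScan G q l U p U' p' t) : ScanSpec G q l U p U' p' := by
  induction h with
  | nil q U p => constructor <;> simp
  | visited q w l U U' p p' t hw _ ih =>
    refine ⟨ih.sub, ih.off, ih.anc, ?_, ih.closed, fun a ha => ?_, ih.comp⟩
    · intro v hv
      rcases List.mem_cons.1 hv with rfl | hv
      · exact fun h => hw (ih.sub h)
      · exact ih.list v hv
    · exact (ih.parent a ha).imp_left fun h => ⟨h.1, List.mem_cons_of_mem _ h.2⟩
  | unvisited q w l k U U₁ U₂ p p₁ p₂ t₁ t₂ hw hk _ _ ih₁ ih₂ =>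
    have hU₁ : U₁ ⊆ U := fun x hx => (ih₁.sub hx).1
    have hwU₁ : w ∉ U₁ := fun h => (ih₁.sub h).2 rfl
    have hA : insert w ((U \ {w}) \ U₁) ⊆ U \ U₂ := by
      rintro x (rfl | hx)
      · exact ⟨hw, fun h => hwU₁ (ih₂.sub h)⟩
      · exact ⟨hx.1.1, fun h => hx.2 (ih₂.sub h)⟩
    have hA' : (U \ {w}) \ U₁ ⊆ U \ U₂ := (Set.subset_insert _ _).trans hA
    have hB : U₁ \ U₂ ⊆ U \ U₂ := fun x hx => ⟨hU₁ hx.1, hx.2⟩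
    have hsplit : ∀ x ∈ U \ U₂, x = w ∨ x ∈ (U \ {w}) \ U₁ ∨ x ∈ U₁ \ U₂ := by
      intro x hx
      by_cases h1 : x = w
      · exact .inl h1
      · by_cases h2 : x ∈ U₁
        · exact .inr (.inr ⟨h2, hx.2⟩)
        · exact .inr (.inl ⟨⟨hx.1, h1⟩, h2⟩)
    have hpA : ∀ v ∈ (U \ {w}) \ U₁, p₂ v = p₁ v := fun v hv => ih₂.off v fun h => hv.2 h.1
    have hpw : p₂ w = q := by
      rw [ih₂.off w fun h => hwU₁ h.1, ih₁.off w fun h => h.1.2 rfl, Function.update_self]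
    have hancw : ∀ a, a = w ∨ a ∈ (U \ {w}) \ U₁ → IsAncestorIn p₂ (U \ U₂) w a := by
      rintro a (rfl | ha)
      · exact .refl
      · obtain ⟨c, hc, hcw, hca⟩ := ih₁.anc a ha
        exact (hca.congr hA' hpA).tail
          ⟨(hpA c hc).trans hcw, hA' hc, hA (Set.mem_insert _ _)⟩
    -- When the call at `w` returns, no neighbour of its vertices is unvisited. Hence no edge leads
    -- to a vertex visited later, which is why DFS trees have no cross edges.
    have hclosedA : ∀ a, a = w ∨ a ∈ (U \ {w}) \ U₁ → ∀ v, G.Adj a v → v ∉ U₁ := by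
      rintro a (rfl | ha) v hv
      · exact ih₁.list v ((hk.2 v).2 hv)
      · exact ih₁.closed a ha v hv
    refine ⟨ih₂.sub.trans hU₁, fun v hv => ?_, fun v hv => ?_, fun v hv => ?_, fun v hv x hx => ?_,
      fun a ha => ?_, fun a ha b hb hab => ?_⟩
    · have hvw : v ≠ w := by
        rintro rfl
        exact hv (hA (Set.mem_insert _ _))
      rw [ih₂.off v fun h => hv (hB h), ih₁.off v fun h => hv (hA' h), Function.update_of_ne hvw]
    · rcases hsplit v hv with h | h | h
      · exact ⟨w, hA (Set.mem_insert _ _), hpw, hancw v (.inl h)⟩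
      · exact ⟨w, hA (Set.mem_insert _ _), hpw, hancw v (.inr h)⟩
      · obtain ⟨c, hc, hcq, hcv⟩ := ih₂.anc v h
        exact ⟨c, hB hc, hcq, hcv.congr hB fun _ _ => rfl⟩
    · rcases List.mem_cons.1 hv with rfl | hv
      · exact fun h => hwU₁ (ih₂.sub h)
      · exact ih₂.list v hv
    · rcases hsplit v hv with h | h | h
      · exact fun h' => hclosedA v (.inl h) x hx (ih₂.sub h')
      · exact fun h' => hclosedA v (.inr h) x hx (ih₂.sub h')
      · exact ih₂.closed v h x hx
    · rcases hsplit a ha with rfl | h | h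
      · exact .inl ⟨hpw, List.mem_cons_self⟩
      · right
        rcases ih₁.parent a h with ⟨h1, h2⟩ | ⟨v, hv, h1, h2⟩
        · exact ⟨w, hA (Set.mem_insert _ _), (hpA a h).trans h1, (hk.2 a).1 h2⟩
        · exact ⟨v, hA' hv, (hpA a h).trans h1, h2⟩
      · rcases ih₂.parent a h with ⟨h1, h2⟩ | ⟨v, hv, h1, h2⟩
        · exact .inl ⟨h1, List.mem_cons_of_mem _ h2⟩
        · exact .inr ⟨v, hB hv, h1, h2⟩
    · rcases hsplit a ha with rfl | h | h <;> rcases hsplit b hb with rfl | h' | h'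
      · exact (G.loopless.irrefl _ hab).elim
      · exact .inl (hancw b (.inr h'))
      · exact (hclosedA _ (.inl rfl) b hab h'.1).elim
      · exact .inr (hancw a (.inr h))
      · exact (ih₁.comp a h b h' hab).imp (·.congr hA' hpA) (·.congr hA' hpA)
      · exact (hclosedA _ (.inr h) b hab h'.1).elim
      · exact (hclosedA _ (.inl rfl) a hab.symm h.1).elim
      · exact (hclosedA _ (.inr h') a hab.symm h.1).elim
      · exact (ih₂.comp a h b h' hab).imp (·.congr hB fun _ _ => rfl) (·.congr hB fun _ _ => rfl)

/-! ### The cost of a depth-first scan -/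

theorem IsAdjList.exists [Fintype V] (G : SimpleGraph V) (v : V) : ∃ l, IsAdjList G v l := by
  classical
  exact ⟨(G.neighborFinset v).toList, Finset.nodup_toList _, by simp⟩

theorem IsAdjList.length_eq [Fintype V] {v : V} {l : List V} (h : IsAdjList G v l) :
    l.length = (G.neighborSet v).ncard := by
  classical
  have : G.neighborSet v = (l.toFinset : Set V) := by ext w; simp [h.2]
  rw [this, Set.ncard_coe_finset, List.toFinset_card_of_nodup h.1]

/-- The cost of visiting all the vertices of `U`. -/
noncomputable def visitCost [Fintype V] (G : SimpleGraph V) (U : Set V) : ℕ :=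
  ∑ v, U.indicator (fun v => 1 + (G.neighborSet v).ncard) v

@[simp]
theorem visitCost_empty [Fintype V] (G : SimpleGraph V) : visitCost G ∅ = 0 := by
  simp [visitCost]

theorem visitCost_insert [Fintype V] (G : SimpleGraph V) {U : Set V} {w : V} (hw : w ∈ U) :
    visitCost G U = 1 + (G.neighborSet w).ncard + visitCost G (U \ {w}) := by
  classical
  unfold visitCost
  rw [← Finset.add_sum_erase _ _ (Finset.mem_univ w), ← Finset.add_sum_erase _ (fun v => (U \ {w}).indicator _ v) (Finset.mem_univ w)]
  simp only [Set.indicator_of_mem hw, Set.mem_sdiff, Set.mem_singleton_iff, not_true, and_false,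
    not_false_eq_true, Set.indicator_of_notMem, zero_add]
  congr 1
  refine Finset.sum_congr rfl fun v hv => ?_
  have : v ≠ w := Finset.ne_of_mem_erase hv
  by_cases hvU : v ∈ U <;> simp [Set.indicator, hvU, this]

/-- An exact balance: the time depends only on which vertices get visited, not on the order. -/
theorem DFSScan.cost [Fintype V] [DecidableEq V] {q : Option V} {l : List V} {U U' : Set V} {t : ℕ}
    (h : DFSScan G q l U p U' p' t) : t + visitCost G U' = l.length + visitCost G U := by
  induction h with
  | nil q U p => simp
  | visited q w l U U' p p' t hw _ ih => simp only [List.length_cons]; omega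
  | unvisited q w l k U U₁ U₂ p p₁ p₂ t₁ t₂ hw hk _ _ ih₁ ih₂ =>
    rw [visitCost_insert G hw, List.length_cons, ← hk.length_eq]
    omega

theorem DFSScan.exists [Fintype V] [DecidableEq V] (G : SimpleGraph V) (q : Option V) (l : List V)
    (U : Set V) (p : V → Option V) : ∃ U' p' t, DFSScan G q l U p U' p' t := by
  -- A visit removes `w` from `U`, so the outer hypothesis covers both the call at `w` and the rest
  -- of the list; the inner induction serves visited entries.
  induction hn : U.ncard using Nat.strong_induction_on generalizing q l U p with
  | _ n ihn =>
    induction l generalizing U p with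
    | nil => exact ⟨U, p, 0, .nil q U p⟩
    | cons w l ih =>
      by_cases hw : w ∈ U
      · obtain ⟨k, hk⟩ := IsAdjList.exists G w
        have hlt : (U \ {w}).ncard < n := hn ▸ Set.ncard_sdiff_singleton_lt_of_mem hw
        obtain ⟨U₁, p₁, t₁, h₁⟩ := ihn _ hlt (some w) k (U \ {w}) (Function.update p w q) rfl
        have hlt' : U₁.ncard < n := (Set.ncard_le_ncard h₁.spec.sub).trans_lt hlt
        obtain ⟨U₂, p₂, t₂, h₂⟩ := ihn _ hlt' q l U₁ p₁ rfl
        exact ⟨U₂, p₂, _, .unvisited q w l k U U₁ U₂ p p₁ p₂ t₁ t₂ hw hk h₁ h₂⟩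
      · obtain ⟨U', p', t, h⟩ := ih U p hn
        exact ⟨U', p', _, .visited q w l U U' p p' t hw h⟩

/-! ### Rehanging a subtree -/

/-- `p'` arises from `p` by replacing the subtree with vertex set `S` by a tree rooted at `y` that
is hung from `x`. -/
structure Rehung (p p' : V → Option V) (S : Set V) (x y : V) : Prop where
  notMem : x ∉ S
  mem : y ∈ S
  down : ∀ a b, p a = some b → b ∈ S → a ∈ S
  off : ∀ v, v ∉ S → p' v = p v
  parent : p' y = some x
  anc : ∀ v ∈ S, IsAncestor p' y v

namespace Rehung

variable {x y r v : V}

theorem isAncestor_and_notMem (h : Rehung p p' S x y) (hv : v ∉ S) (hr : IsAncestor p r v) :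
    IsAncestor p' r v ∧ r ∉ S := by
  induction hr using Relation.ReflTransGen.head_induction_on with
  | refl => exact ⟨.refl _ _, hv⟩
  | head hab _ ih =>
    obtain ⟨h1, h2⟩ := ih fun hc => hv (h.down _ _ hab hc)
    exact ⟨h1.trans (.of_parent ((h.off _ hv).trans hab)), h2⟩

theorem isAncestor_and_notMem' (h : Rehung p p' S x y) (hv : v ∉ S) (hr : IsAncestor p' r v) :
    IsAncestor p r v ∧ r ∉ S := by
  induction hr using Relation.ReflTransGen.head_induction_on with
  | refl => exact ⟨.refl _ _, hv⟩
  | head hab _ ih =>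
    rw [h.off _ hv] at hab
    obtain ⟨h1, h2⟩ := ih fun hc => hv (h.down _ _ hab hc)
    exact ⟨h1.trans (.of_parent hab), h2⟩

theorem isAncestor_off (h : Rehung p p' S x y) (hv : v ∉ S) :
    IsAncestor p' r v ↔ IsAncestor p r v :=
  ⟨fun hr => (h.isAncestor_and_notMem' hv hr).1, fun hr => (h.isAncestor_and_notMem hv hr).1⟩

/-- In the new tree the way up from `v` can leave `S` only from `y` to `x`. -/
theorem isAncestor_on (h : Rehung p p' S x y) (hv : v ∈ S) (hr : r ∉ S) :
    IsAncestor p' r v ↔ IsAncestor p r x := by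
  constructor
  · intro hrv
    rcases hrv.comparable (h.anc v hv) with h1 | h1
    · rcases h1.eq_or_parent with rfl | ⟨c, hc, hrc⟩
      · exact (hr h.mem).elim
      · rw [h.parent] at hc
        cases hc
        exact (h.isAncestor_off h.notMem).1 hrc
    · exact ((h.isAncestor_and_notMem' hr h1).2 h.mem).elim
  · intro hrx
    exact (((h.isAncestor_off h.notMem).2 hrx).trans (.of_parent h.parent)).trans (h.anc v hv)

theorem subtree_root (h : Rehung p p' S x y) : subtree p' y = S := by
  ext v
  refine ⟨fun hv => ?_, h.anc v⟩
  by_contra hvS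
  exact (h.isAncestor_and_notMem' hvS hv).2 h.mem

theorem subtree_of_mem (h : Rehung p p' S x y) (hr : r ∉ S) (hx : x ∈ subtree p r) :
    subtree p' r = subtree p r ∪ S := by
  ext v
  by_cases hv : v ∈ S
  · exact ⟨fun _ => .inr hv, fun _ => (h.isAncestor_on hv hr).2 hx⟩
  · exact (h.isAncestor_off hv).trans ⟨.inl, fun h' => h'.resolve_right hv⟩

theorem subtree_of_disjoint (h : Rehung p p' S x y) (hx : x ∉ subtree p r)
    (hd : Disjoint (subtree p r) S) : subtree p' r = subtree p r := by
  have hr : r ∉ S := Set.disjoint_left.1 hd (.refl p r)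
  ext v
  by_cases hv : v ∈ S
  · exact ⟨fun h' => (hx ((h.isAncestor_on hv hr).1 h')).elim,
      fun h' => (Set.disjoint_left.1 hd h' hv).elim⟩
  · exact h.isAncestor_off hv

end Rehung

/-- `S` is the vertex set of the subtree of a child of `z`. -/
def Hangs (p : V → Option V) (S : Set V) (z : Option V) : Prop := ∃ v, p v = z ∧ subtree p v = S

theorem Rehung.hangs {x y : V} (h : Rehung p p' S x y) : Hangs p' S (some x) :=
  ⟨y, h.parent, h.subtree_root⟩

theorem Rehung.hangs_of_disjoint {x y : V} {T : Set V} {z : Option V} (h : Rehung p p' S x y)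
    (hT : Hangs p T z) (hx : x ∉ T) (hd : Disjoint T S) : Hangs p' T z := by
  obtain ⟨v, hv, rfl⟩ := hT
  exact ⟨v, (h.off v (Set.disjoint_left.1 hd (.refl p v))).trans hv, h.subtree_of_disjoint hx hd⟩

/-! ### Depth-first search forests -/

/-- `p` is a depth-first search forest of `G`: the roots hang from the pseudo root, and every edge
of `G` joins comparable vertices. -/
structure IsDFSForest (G : SimpleGraph V) (p : V → Option V) : Prop where
  rooted : IsRooted p
  adj : ∀ a b, p b = some a → G.Adj a b
  comp : ∀ a b, G.Adj a b → IsAncestor p a b ∨ IsAncestor p b a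

theorem isDFSForest_bot : IsDFSForest (⊥ : SimpleGraph V) fun _ => none :=
  ⟨fun v => ⟨v, rfl, .refl _ v⟩, by simp, by simp⟩

theorem addEdge_adj {x y a b : V} :
    (addEdge G s(x, y)).Adj a b ↔ G.Adj a b ∨ (s(a, b) = s(x, y) ∧ a ≠ b) := by
  simp [addEdge]

theorem le_addEdge (e : Sym2 V) : G ≤ addEdge G e := le_sup_left

/-- Rebuilding a subtree yields a depth-first search forest. -/
theorem IsDFSForest.rebuild [DecidableEq V] (hf : IsDFSForest G p) {x y u v : V}
    (hc : AreCandidates p x y u v) {U' : Set V} {t : ℕ}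
    (hs : DFSScan (addEdge G s(x, y)) (some x) [y] (subtree p v) p U' p' t) :
    IsDFSForest (addEdge G s(x, y)) p' ∧ Rehung p p' (subtree p v) x y ∧ U' = ∅ := by
  set G' := addEdge G s(x, y) with hG'
  have hle : ∀ {a b}, G.Adj a b → G'.Adj a b := fun h => le_addEdge _ h
  obtain ⟨huv, hpuv, hx, hy⟩ := hc
  have hxS : x ∉ subtree p v := Set.disjoint_left.1 (hf.rooted.disjoint_siblings huv hpuv) hx
  have sp := hs.spec
  have hyU : y ∉ U' := sp.list y (by simp)
  -- Tree edges are edges of the graph, so visits spread from `y` up to `v`, and from `v` down to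
  -- all of `T(v)`.
  have hv : v ∉ U' := by
    have : ∀ w, IsAncestor p w y → IsAncestor p v w → w ∉ U' := by
      intro w hw
      induction hw with
      | refl => exact fun _ => hyU
      | tail hab hbc ih =>
        intro hvc
        have hvb := hvc.trans (.of_parent hbc)
        exact sp.closed _ ⟨hvb, ih hvb⟩ _ (hle (hf.adj _ _ hbc).symm)
    exact this v hy (.refl p v)
  have hU' : U' = ∅ := by
    have : ∀ w, IsAncestor p v w → w ∉ U' := by
      intro w hw
      induction hw using Relation.ReflTransGen.head_induction_on with
      | refl => exact hv
      | head hab hbc ih => exact sp.closed _ ⟨hbc, ih⟩ _ (hle (hf.adj _ _ hab))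
    exact Set.eq_empty_iff_forall_notMem.2 fun w hw => this w (sp.sub hw) hw
  subst hU'
  obtain ⟨-, spoff, spanc, -, -, spparent, spcomp⟩ := sp
  simp only [Set.sdiff_empty] at spoff spanc spparent spcomp
  have hroot : ∀ c ∈ subtree p v, p' c = some x → c = y := by
    intro c hc hcx
    rcases spparent c hc with ⟨-, h⟩ | ⟨w, hw, h, -⟩
    · simpa using h
    · rw [hcx] at h
      cases h
      exact (hxS hw).elim
  have hanc : ∀ w ∈ subtree p v, p' y = some x ∧ IsAncestor p' y w := by
    intro w hw
    obtain ⟨c, hc, hcx, hcw⟩ := spanc w hw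
    obtain rfl := hroot c hc hcx
    exact ⟨hcx, hcw.isAncestor⟩
  have hR : Rehung p p' (subtree p v) x y :=
    ⟨hxS, hy, fun a b hab hb => IsAncestor.trans hb (.of_parent hab), spoff, (hanc y hy).1,
      fun w hw => (hanc w hw).2⟩
  refine ⟨⟨fun w => ?_, fun a b hab => ?_, ?_⟩, hR, rfl⟩
  · have hout : ∀ w, w ∉ subtree p v → ∃ r, p' r = none ∧ IsAncestor p' r w := by
      intro w hw
      obtain ⟨r, hr, hrw⟩ := hf.rooted w
      obtain ⟨h1, h2⟩ := hR.isAncestor_and_notMem hw hrw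
      exact ⟨r, (hR.off r h2).trans hr, h1⟩
    by_cases hw : w ∈ subtree p v
    · obtain ⟨r, hr, hrx⟩ := hout x hxS
      exact ⟨r, hr, (hrx.trans (.of_parent hR.parent)).trans (hR.anc w hw)⟩
    · exact hout w hw
  · by_cases hb : b ∈ subtree p v
    · rcases spparent b hb with ⟨h1, h2⟩ | ⟨w, hw, h1, h2⟩
      · obtain rfl : b = y := by simpa using h2
        rw [hab] at h1
        cases h1
        exact addEdge_adj.2 (.inr ⟨rfl, fun h => hxS (h ▸ hb)⟩)
      · rw [hab] at h1
        cases h1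
        exact h2
    · rw [hR.off b hb] at hab
      exact hle (hf.adj _ _ hab)
  -- An old edge leaving `T(v)` ends in a proper ancestor of `v`. This is an ancestor of the common
  -- parent of `u` and `v`, hence of `x`, from which the new tree hangs.
  · have hmixed : ∀ a b, a ∈ subtree p v → b ∉ subtree p v → G'.Adj a b → IsAncestor p' b a := by
      intro a b ha hb hab
      rw [hR.isAncestor_on ha hb]
      rcases addEdge_adj.1 hab with h | ⟨h, -⟩
      · have hba : IsAncestor p b a := by
          rcases hf.comp a b h with h' | h'
          · exact (hb (IsAncestor.trans ha h')).elim
          · exact h'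
        rcases hba.comparable ha with h' | h'
        · rcases h'.eq_or_parent with rfl | ⟨c, hc, hbc⟩
          · exact (hb (.refl p _)).elim
          · exact (hbc.trans (.of_parent (hpuv.trans hc))).trans hx
        · exact (hb h').elim
      · rcases Sym2.eq_iff.1 h with ⟨rfl, rfl⟩ | ⟨rfl, rfl⟩
        · exact (hxS ha).elim
        · exact .refl p _
    intro a b hab
    by_cases ha : a ∈ subtree p v <;> by_cases hb : b ∈ subtree p v
    · exact (spcomp a ha b hb hab).imp (·.isAncestor) (·.isAncestor)
    · exact .inr (hmixed a b ha hb hab)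
    · exact .inl (hmixed b a hb ha hab.symm)
    · rw [hR.isAncestor_off ha, hR.isAncestor_off hb]
      rcases addEdge_adj.1 hab with h | ⟨h, -⟩
      · exact hf.comp a b h
      · rcases Sym2.eq_iff.1 h with ⟨rfl, rfl⟩ | ⟨rfl, rfl⟩
        · exact (hb hy).elim
        · exact (ha hy).elim

/-! ### Single insertions of SDFS3 -/

theorem IsDFSForest.of_back (hf : IsDFSForest G p) {x y : V} (h : IsAncestor p x y) :
    IsDFSForest (addEdge G s(x, y)) p := by
  refine ⟨hf.rooted, fun a b hab => le_addEdge _ (hf.adj a b hab), fun a b hab => ?_⟩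
  rcases addEdge_adj.1 hab with h' | ⟨h', -⟩
  · exact hf.comp a b h'
  · rcases Sym2.eq_iff.1 h' with ⟨rfl, rfl⟩ | ⟨rfl, rfl⟩
    · exact .inl h
    · exact .inr h

/-- SDFS3 maintains a depth-first search forest. -/
theorem SDFS3Insert.isDFSForest [DecidableEq V] (hf : IsDFSForest G p) {e : Sym2 V} {t : ℕ}
    (h : SDFS3Insert G p e p' t) : IsDFSForest (addEdge G e) p' := by
  cases h with
  | back x y h => exact hf.of_back h
  | cross x y u v U' p' t _ _ hc _ hs => exact (hf.rebuild hc hs).1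

theorem SDFS3Insert.one_le [DecidableEq V] {e : Sym2 V} {t : ℕ}
    (h : SDFS3Insert G p e p' t) : 1 ≤ t := by
  cases h with
  | back => exact le_rfl
  | cross => omega

theorem SDFS3Insert.exists [Fintype V] [DecidableEq V] (hf : IsDFSForest G p) (e : Sym2 V) :
    ∃ p' t, SDFS3Insert G p e p' t := by
  induction e using Sym2.ind with
  | _ x y =>
    by_cases hxy : IsAncestor p x y
    · exact ⟨p, 1, .back x y hxy⟩
    by_cases hyx : IsAncestor p y x
    · exact ⟨p, 1, Sym2.eq_swap ▸ .back y x hyx⟩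
    obtain ⟨u, v, hc⟩ := hf.rooted.exists_candidates hxy hyx
    rcases le_total (subtree p v).ncard (subtree p u).ncard with h | h
    · obtain ⟨U', p', t, hs⟩ := DFSScan.exists (addEdge G s(x, y)) (some x) [y] (subtree p v) p
      exact ⟨p', _, .cross x y u v U' p' t hxy hyx hc h hs⟩
    · obtain ⟨U', p', t, hs⟩ := DFSScan.exists (addEdge G s(y, x)) (some y) [x] (subtree p u) p
      rw [Sym2.eq_swap]
      exact ⟨p', _, .cross y x v u U' p' t hyx hxy hc.symm h hs⟩

/-- If the subtree with vertex set `S` is the smaller one, then the insertion of `(x, y)` hangs it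
from `x`. -/
theorem SDFS3Insert.rehung [Fintype V] [DecidableEq V] (hf : IsDFSForest G p) {x y u : V}
    {z : Option V} {t : ℕ} (hS : Hangs p S z) (hy : y ∈ S) (hu : p u = z) (hx : IsAncestor p u x)
    (huS : u ∉ S) (hcard : S.ncard < (subtree p u).ncard)
    (h : SDFS3Insert G p s(x, y) p' t) :
    Rehung p p' S x y ∧ visitCost (addEdge G s(x, y)) S ≤ t := by
  obtain ⟨v, hv, rfl⟩ := hS
  have hc : AreCandidates p x y u v :=
    ⟨fun h => huS (h ▸ .refl p v), hu.trans hv.symm, hx, hy⟩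
  have hxy := hf.rooted.not_isAncestor_of_candidates hc
  have hyx := hf.rooted.not_isAncestor_of_candidates hc.symm
  generalize he : s(x, y) = e at h
  cases h with
  | back x' y' h =>
    rcases Sym2.eq_iff.1 he with ⟨rfl, rfl⟩ | ⟨rfl, rfl⟩
    · exact (hxy h).elim
    · exact (hyx h).elim
  | cross x' y' u' v' U' p' t _ _ hc' hle hs =>
    rcases Sym2.eq_iff.1 he with ⟨rfl, rfl⟩ | ⟨rfl, rfl⟩
    · obtain ⟨rfl, rfl⟩ := hf.rooted.siblings_unique hc' hc
      obtain ⟨-, h1, rfl⟩ := hf.rebuild hc' hs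
      refine ⟨h1, ?_⟩
      have := hs.cost
      rw [visitCost_empty, List.length_singleton] at this
      omega
    -- With the endpoints exchanged, `T(u)` would be the one rebuilt, against the strict inequality
    -- `hcard`.
    · obtain ⟨rfl, rfl⟩ := hf.rooted.siblings_unique hc' hc.symm
      omega

/-- Under the same hypotheses the edge is a new one. -/
theorem IsDFSForest.not_adj_of_hangs (hf : IsDFSForest G p) {x y u : V}
    {z : Option V} (hS : Hangs p S z) (hy : y ∈ S) (hu : p u = z) (hx : IsAncestor p u x)
    (huS : u ∉ S) : s(x, y) ∉ G.edgeSet ∧ ¬ s(x, y).IsDiag := by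
  obtain ⟨v, hv, rfl⟩ := hS
  have hc : AreCandidates p x y u v :=
    ⟨fun h => huS (h ▸ .refl p v), hu.trans hv.symm, hx, hy⟩
  have hxy := hf.rooted.not_isAncestor_of_candidates hc
  have hyx := hf.rooted.not_isAncestor_of_candidates hc.symm
  refine ⟨fun h => (hf.comp x y h).elim hxy hyx, fun h => ?_⟩
  rw [Sym2.mk_isDiag_iff] at h
  exact hxy (h ▸ .refl p x)

/-! ### Components below a vertex -/

/-- The proper descendants of a vertex or of the pseudo root. -/
def below (p : V → Option V) : Option V → Set V
  | none => Set.univ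
  | some y => subtree p y \ {y}

theorem IsRooted.exists_child (h : IsRooted p) {z : Option V} {s : V} (hs : s ∈ below p z) :
    ∃ c, p c = z ∧ IsAncestor p c s := by
  cases z with
  | none => exact h s
  | some y =>
    obtain ⟨hs, hne⟩ := hs
    have hs : IsAncestor p y s := hs
    rcases (Relation.ReflTransGen.cases_tail hs) with h' | ⟨c, hc, hcy⟩
    · exact (hne h'.symm).elim
    · exact ⟨c, hcy, hc⟩

theorem IsRooted.mem_below (h : IsRooted p) {z : Option V} {c s : V} (hc : p c = z)
    (hs : IsAncestor p c s) : s ∈ below p z := by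
  cases z with
  | none => trivial
  | some y =>
    refine ⟨(IsAncestor.of_parent hc).trans hs, ?_⟩
    rintro rfl
    exact h.not_isAncestor_parent hc hs

theorem IsRooted.isAncestor_of_below (h : IsRooted p) {z : Option V} {b c : V} (hc : p c = z)
    (hb : b ∈ below p z) (hbc : IsAncestor p b c) : IsAncestor p c b := by
  rcases hbc.eq_or_parent with rfl | ⟨a, ha, hba⟩
  · exact .refl p _
  · cases z with
    | none => simp [hc] at ha
    | some y =>
      rw [hc] at ha
      cases ha
      exact (hb.2 (h.antisymm hba hb.1)).elim

/-- A connected component of the graph below `z` is the subtree of a child of `z`. -/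
theorem IsDFSForest.hangs_of_component (hf : IsDFSForest G p) {z : Option V}
    (hsub : S ⊆ below p z) (hne : S.Nonempty)
    (hclosed : ∀ a ∈ S, ∀ b ∈ below p z, G.Adj a b → b ∈ S)
    (hconn : ∀ T ⊆ S, T.Nonempty → (∀ a ∈ T, ∀ b ∈ S, G.Adj a b → b ∈ T) → T = S) :
    Hangs p S z := by
  obtain ⟨s, hs⟩ := hne
  obtain ⟨c, hc, hcs⟩ := hf.rooted.exists_child (hsub hs)
  -- Tree edges below `z` cannot leave `S`: neither on the way up from `s` to `c`, nor on the way
  -- down into `T(c)`.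
  have hup : ∀ w, IsAncestor p w s → IsAncestor p c w → w ∈ S := by
    intro w hw
    induction hw with
    | refl => exact fun _ => hs
    | tail hab hbc ih =>
      intro hvc
      exact hclosed _ (ih (hvc.trans (.of_parent hbc))) _ (hf.rooted.mem_below hc hvc)
        (hf.adj _ _ hbc).symm
  have hcS : subtree p c ⊆ S := by
    intro w hw
    have hw : IsAncestor p c w := hw
    induction hw using Relation.ReflTransGen.head_induction_on with
    | refl => exact hup c hcs (.refl p c)
    | head hab hbc ih =>
      exact hclosed _ (ih hbc) _ (hf.rooted.mem_below hc (IsAncestor.trans hbc (.of_parent hab)))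
        (hf.adj _ _ hab)
  -- `T(c)` is closed under adjacency within `S`, because adjacent vertices are comparable and `c`
  -- has no proper ancestor below `z`. Connectedness makes it all of `S`.
  refine ⟨c, hc, hconn _ hcS ⟨c, .refl p c⟩ fun a ha b hb hab => ?_⟩
  rcases hf.comp a b hab with h | h
  · exact IsAncestor.trans ha h
  · rcases IsAncestor.comparable ha h with h' | h'
    · exact h'
    · exact hf.rooted.isAncestor_of_below hc (hsub hb) h'

/-! ### Guarantees that hold whatever choices are made -/

/-- The edges in the list are new when they are inserted, and however SDFS3 inserts them, it takes
at least `N` steps and ends in a graph and a tree that satisfy `Post`. -/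
def Ensures [DecidableEq V] (Post : SimpleGraph V → (V → Option V) → Prop) :
    SimpleGraph V → (V → Option V) → List (Sym2 V) → ℕ → Prop
  -- `N` is a debt of steps to be paid off by the end; truncated subtraction makes overpayment
  -- harmless.
  | G, p, [], N => N = 0 ∧ Post G p
  | G, p, e :: es, N => (e ∉ G.edgeSet ∧ ¬ e.IsDiag) ∧
      ∀ p' t, SDFS3Insert G p e p' t → Ensures Post (addEdge G e) p' es (N - t)

theorem mem_edgeSet_addEdge_iff {e f : Sym2 V} (he : ¬ e.IsDiag) :
    f ∈ (addEdge G e).edgeSet ↔ f ∈ G.edgeSet ∨ f = e := by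
  rw [addEdge, SimpleGraph.edgeSet_sup, SimpleGraph.edgeSet_fromEdgeSet, Set.mem_union]
  refine or_congr_right ⟨fun h => h.1, fun h => ⟨h, ?_⟩⟩
  subst h
  exact he

section Ensures

variable [DecidableEq V] {Post Post' : SimpleGraph V → (V → Option V) → Prop}

theorem Ensures.mono (hP : ∀ G p, Post G p → Post' G p) {es : List (Sym2 V)} {N N' : ℕ}
    (h : Ensures Post G p es N) (hN : N' ≤ N) : Ensures Post' G p es N' := by
  induction es generalizing G p N N' with
  | nil => exact ⟨by have := h.1; omega, hP _ _ h.2⟩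
  | cons e es ih => exact ⟨h.1, fun p' t ht => ih (h.2 p' t ht) (by omega)⟩

theorem Ensures.append {es fs : List (Sym2 V)} {N M : ℕ}
    (h : Ensures (fun G p => Ensures Post G p fs M) G p es N) :
    Ensures Post G p (es ++ fs) (N + M) := by
  induction es generalizing G p N with
  | nil => obtain ⟨rfl, h⟩ := h; simpa using h
  | cons e es ih =>
    exact ⟨h.1, fun p' t ht => (ih (h.2 p' t ht)).mono (fun _ _ h => h) (by omega)⟩

theorem Ensures.cons {e : Sym2 V} {es : List (Sym2 V)} {N M : ℕ}
    (he : e ∉ G.edgeSet ∧ ¬ e.IsDiag)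
    (h : ∀ p' t, SDFS3Insert G p e p' t → N ≤ t ∧ Ensures Post (addEdge G e) p' es M) :
    Ensures Post G p (e :: es) (N + M) :=
  ⟨he, fun p' t ht => (h p' t ht).2.mono (fun _ _ h => h) (by have := (h p' t ht).1; omega)⟩

theorem Ensures.nil (h : Post G p) : Ensures Post G p [] 0 := ⟨rfl, h⟩

/-- Some run exists, so the universal statement is not vacuous; along this run each edge is new with
respect to all earlier ones. -/
theorem Ensures.nodup [Fintype V] {es : List (Sym2 V)} {N : ℕ} (hf : IsDFSForest G p)
    (h : Ensures Post G p es N) :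
    es.Nodup ∧ ∀ e ∈ es, e ∉ G.edgeSet ∧ ¬ e.IsDiag := by
  induction es generalizing G p N with
  | nil => simp
  | cons e es ih =>
    obtain ⟨p', t, ht⟩ := SDFS3Insert.exists hf e
    obtain ⟨h1, h2⟩ := ih (ht.isDFSForest hf) (h.2 p' t ht)
    simp only [mem_edgeSet_addEdge_iff h.1.2, not_or] at h2
    refine ⟨List.nodup_cons.2 ⟨fun he => (h2 e he).1.2 rfl, h1⟩, fun f hf => ?_⟩
    rcases List.mem_cons.1 hf with rfl | hf
    · exact h.1
    · exact ⟨(h2 f hf).1.1, (h2 f hf).2⟩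

theorem Ensures.le_of_run {es fs : List (Sym2 V)} {N t : ℕ} (h : Ensures Post G p es N)
    (hr : SDFS3Run G p (es ++ fs) t) : N ≤ t := by
  induction es generalizing G p N t with
  | nil => rw [h.1]; exact Nat.zero_le t
  | cons e es ih =>
    cases hr with
    | cons _ _ p' _ _ t t' hi hr =>
      have := ih (h.2 p' t hi) hr
      omega

/-- Any insertions of new edges maintain a depth-first search forest. -/
theorem Ensures.of_nodup {es : List (Sym2 V)} (hf : IsDFSForest G p) (hes : es.Nodup)
    (hnew : ∀ e ∈ es, e ∉ G.edgeSet ∧ ¬ e.IsDiag) :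
    Ensures (fun G' p' => G' = G ⊔ SimpleGraph.fromEdgeSet {e | e ∈ es} ∧ IsDFSForest G' p')
      G p es 0 := by
  induction es generalizing G p with
  | nil => exact .nil ⟨by simp, hf⟩
  | cons e es ih =>
    obtain ⟨he, hes⟩ := List.nodup_cons.1 hes
    refine ⟨hnew e (by simp), fun p' t ht => ?_⟩
    refine (ih (ht.isDFSForest hf) hes fun f hf => ?_).mono (fun G' q h => ?_) (by omega)
    · obtain ⟨h1, h2⟩ := hnew f (List.mem_cons_of_mem _ hf)
      rw [mem_edgeSet_addEdge_iff (hnew e (by simp)).2]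
      exact ⟨fun h => h.elim h1 fun h => he (h ▸ hf), h2⟩
    · refine ⟨?_, h.2⟩
      rw [h.1, addEdge, sup_assoc, ← SimpleGraph.fromEdgeSet_union]
      congr 2
      ext f
      simp

end Ensures

/-! ### Every run exists and takes at most quadratic time -/

theorem SDFS3Run.exists [Fintype V] [DecidableEq V] (hf : IsDFSForest G p) (es : List (Sym2 V)) :
    ∃ t, SDFS3Run G p es t := by
  induction es generalizing G p with
  | nil => exact ⟨0, .nil G p⟩
  | cons e es ih =>
    obtain ⟨p', t, ht⟩ := SDFS3Insert.exists hf e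
    obtain ⟨t', ht'⟩ := ih (ht.isDFSForest hf)
    exact ⟨t + t', .cons G p p' e es t t' ht ht'⟩

theorem SDFS3Run.length_le [DecidableEq V] {es : List (Sym2 V)} {t : ℕ}
    (h : SDFS3Run G p es t) : es.length ≤ t := by
  induction h with
  | nil => simp
  | cons G p p' e es t t' hi _ ih =>
    have := hi.one_le
    simp only [List.length_cons]
    omega

theorem visitCost_mono [Fintype V] {G' : SimpleGraph V} {T : Set V} (hG : G ≤ G') (hS : S ⊆ T) :
    visitCost G S ≤ visitCost G' T := by
  refine Finset.sum_le_sum fun v _ => ?_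
  by_cases hv : v ∈ S
  · rw [Set.indicator_of_mem hv, Set.indicator_of_mem (hS hv)]
    exact Nat.add_le_add_left (Set.ncard_le_ncard fun w hw => hG hw) 1
  · rw [Set.indicator_of_notMem hv]
    exact Nat.zero_le _

theorem visitCost_univ [Fintype V] (G : SimpleGraph V) :
    visitCost G Set.univ = Fintype.card V + 2 * G.edgeSet.ncard := by
  classical
  have h : ∀ v, (G.neighborSet v).ncard = G.degree v := fun v => by
    rw [← SimpleGraph.card_neighborSet_eq_degree, Set.ncard_eq_toFinset_card', Set.toFinset_card]
  simp only [visitCost, Set.indicator_univ, h, Finset.sum_add_distrib,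
    G.sum_degrees_eq_twice_card_edges]
  rw [Set.ncard_eq_toFinset_card']
  simp [SimpleGraph.edgeFinset]

theorem ncard_edgeSet_addEdge_le [Fintype V] (e : Sym2 V) :
    (addEdge G e).edgeSet.ncard ≤ G.edgeSet.ncard + 1 := by
  refine (Set.ncard_le_ncard (t := insert e G.edgeSet) ?_).trans (Set.ncard_insert_le _ _)
  intro f hf
  rw [addEdge, SimpleGraph.edgeSet_sup, SimpleGraph.edgeSet_fromEdgeSet] at hf
  exact hf.elim .inr fun h => .inl h.1

theorem DFSScan.time_le [Fintype V] [DecidableEq V] {q : Option V} {l : List V} {U U' : Set V}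
    {t : ℕ} (h : DFSScan G q l U p U' p' t) :
    t ≤ l.length + Fintype.card V + 2 * G.edgeSet.ncard := by
  have h1 := h.cost
  have h2 := visitCost_mono (le_refl G) (Set.subset_univ U)
  rw [visitCost_univ] at h2
  omega

theorem SDFS3Insert.time_le [Fintype V] [DecidableEq V] {e : Sym2 V} {t : ℕ}
    (h : SDFS3Insert G p e p' t) :
    t ≤ 4 + 4 * Fintype.card V + 2 * G.edgeSet.ncard := by
  cases h with
  | back => omega
  | cross x y u v U' p' t _ _ _ _ hs =>
    have h1 := hs.time_le
    have h2 := ncard_edgeSet_addEdge_le (G := G) s(x, y)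
    have h3 : (subtree p v).ncard ≤ Fintype.card V := by
      rw [← Nat.card_eq_fintype_card]
      exact Set.ncard_le_card _
    simp only [List.length_singleton] at h1
    omega

theorem SDFS3Run.time_le [Fintype V] [DecidableEq V] {es : List (Sym2 V)} {t : ℕ}
    (h : SDFS3Run G p es t) : t ≤
      es.length * (2 + 4 * Fintype.card V + 2 * (G.edgeSet.ncard + es.length)) := by
  induction h with
  | nil => simp
  | cons G p p' e es t t' hi _ ih =>
    have h1 := hi.time_le
    have h2 := ncard_edgeSet_addEdge_le (G := G) e
    have h3 : es.length * (2 + 4 * Fintype.card V +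
        2 * ((addEdge G e).edgeSet.ncard + es.length)) ≤
        es.length * (2 + 4 * Fintype.card V + 2 * (G.edgeSet.ncard + (es.length + 1))) :=
      Nat.mul_le_mul_left _ (by omega)
    rw [List.length_cons, Nat.succ_mul]
    omega

theorem SDFSRun.exists [Fintype V] [DecidableEq V] (G : SimpleGraph V) (es : List (Sym2 V)) :
    ∃ t, SDFSRun G es t := by
  induction es generalizing G with
  | nil => exact ⟨0, .nil G⟩
  | cons e es ih =>
    obtain ⟨U', p', t, ht⟩ := DFSScan.exists (addEdge G e) none (Finset.univ : Finset V).toList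
      Set.univ fun _ => none
    obtain ⟨t', ht'⟩ := ih (addEdge G e)
    exact ⟨_, .cons G e es _ U' p' t t' (Finset.nodup_toList _) (by simp) ht ht'⟩

theorem SDFSRun.time_le [Fintype V] [DecidableEq V] {es : List (Sym2 V)} {t : ℕ}
    (h : SDFSRun G es t) : t ≤
      es.length * (1 + 2 * Fintype.card V + 2 * (G.edgeSet.ncard + es.length)) := by
  induction h with
  | nil => simp
  | cons G e es l U' p' t t' hl _ hs _ ih =>
    have h1 := hs.time_le
    have h2 := ncard_edgeSet_addEdge_le (G := G) e
    have h3 : es.length * (1 + 2 * Fintype.card V +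
        2 * ((addEdge G e).edgeSet.ncard + es.length)) ≤
        es.length * (1 + 2 * Fintype.card V + 2 * (G.edgeSet.ncard + (es.length + 1))) :=
      Nat.mul_le_mul_left _ (by omega)
    have h4 := hl.length_le_card
    rw [List.length_cons, Nat.succ_mul]
    omega

/-! ### An induced path and a clique -/

/-- `P 0, …, P (L - 1)` is an induced path, `K` is a clique, and no edges join them. -/
structure IsPathAndClique (G : SimpleGraph V) (P : ℕ → V) (L : ℕ) (K : Finset V) : Prop where
  path : ∀ i, i + 1 < L → G.Adj (P i) (P (i + 1))
  induced : ∀ i j, i < j → j < L → G.Adj (P i) (P j) → j = i + 1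
  clique : ∀ a ∈ K, ∀ b ∈ K, a ≠ b → G.Adj a b
  sep : ∀ i < L, ∀ a ∈ K, ¬ G.Adj (P i) a

variable {P : ℕ → V} {L : ℕ} {K W : Finset V}

/-- One endpoint outside path and clique suffices, which every insertion of a phase provides once
`d` is taken out of the clique. -/
theorem IsPathAndClique.addEdge (h : IsPathAndClique G P L K) {x y : V}
    (hP : x ∉ P '' Set.Ico 0 L) (hK : x ∉ K) : IsPathAndClique (addEdge G s(x, y)) P L K := by
  have hP : ∀ i < L, P i ≠ x := fun i hi h => hP ⟨i, ⟨Nat.zero_le _, hi⟩, h⟩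
  refine ⟨fun i hi => le_addEdge _ (h.path i hi), fun i j hij hj hadj => ?_,
    fun a ha b hb hab => le_addEdge _ (h.clique a ha b hb hab), fun i hi a ha hadj => ?_⟩
  · rcases addEdge_adj.1 hadj with h' | ⟨h', -⟩
    · exact h.induced i j hij hj h'
    · rcases Sym2.eq_iff.1 h' with ⟨h1, -⟩ | ⟨-, h1⟩
      · exact (hP i (hij.trans hj) h1).elim
      · exact (hP j hj h1).elim
  · rcases addEdge_adj.1 hadj with h' | ⟨h', -⟩
    · exact h.sep i hi a ha h'
    · rcases Sym2.eq_iff.1 h' with ⟨h1, -⟩ | ⟨-, rfl⟩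
      · exact hP i hi h1
      · exact hK ha

theorem IsPathAndClique.subset (h : IsPathAndClique G P L K) {K' : Finset V} (hK : K' ⊆ K) :
    IsPathAndClique G P L K' :=
  ⟨h.path, h.induced, fun a ha b hb => h.clique a (hK ha) b (hK hb),
    fun i hi a ha => h.sep i hi a (hK ha)⟩

theorem IsPathAndClique.path_connected (h : IsPathAndClique G P L K) (i : ℕ) (T : Set V)
    (hT : T ⊆ P '' Set.Ico i L) (hne : T.Nonempty)
    (hclosed : ∀ a ∈ T, ∀ b ∈ P '' Set.Ico i L, G.Adj a b → b ∈ T) : T = P '' Set.Ico i L := by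
  refine hT.antisymm ?_
  obtain ⟨v, hv⟩ := hne
  obtain ⟨j, ⟨hij, hj⟩, rfl⟩ := hT hv
  have hup : ∀ d, j + d < L → P (j + d) ∈ T := by
    intro d
    induction d with
    | zero => exact fun _ => hv
    | succ d ih =>
      intro hd
      exact hclosed _ (ih (by omega)) _ ⟨_, ⟨by omega, hd⟩, rfl⟩ (h.path _ hd)
  have hdown : ∀ d k, k + d = j → i ≤ k → P k ∈ T := by
    intro d
    induction d with
    | zero => rintro k rfl _; exact hv
    | succ d ih =>
      intro k hk hik
      exact hclosed _ (ih (k + 1) (by omega) (by omega)) _ ⟨_, ⟨hik, by omega⟩, rfl⟩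
        (h.path k (by omega)).symm
  rintro _ ⟨k, ⟨hik, hk⟩, rfl⟩
  rcases le_total k j with hkj | hkj
  · exact hdown (j - k) k (by omega) hik
  · have := hup (k - j) (by omega)
    rwa [Nat.add_sub_cancel' hkj] at this

theorem IsPathAndClique.clique_connected (h : IsPathAndClique G P L K) (T : Set V)
    (hT : T ⊆ K) (hne : T.Nonempty)
    (hclosed : ∀ a ∈ T, ∀ b ∈ (K : Set V), G.Adj a b → b ∈ T) : T = K := by
  refine hT.antisymm fun b hb => ?_
  obtain ⟨a, ha⟩ := hne
  by_cases hab : a = b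
  · exact hab ▸ ha
  · exact hclosed a ha b hb (h.clique a (hT ha) b hb hab)

/-- A subtree whose vertices form an induced path and whose root is an end of this path is that
path. -/
theorem IsDFSForest.parent_path (hf : IsDFSForest G p) (h : IsPathAndClique G P L K)
    (hinj : Set.InjOn P (Set.Ico 0 L)) (h0 : subtree p (P 0) = P '' Set.Ico 0 L) (i : ℕ)
    (hi : i + 1 < L) : p (P (i + 1)) = some (P i) := by
  have key : ∀ i, i + 1 < L → subtree p (P i) = P '' Set.Ico i L →
      p (P (i + 1)) = some (P i) ∧ subtree p (P (i + 1)) = P '' Set.Ico (i + 1) L := by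
    intro i hi hsub
    have hbelow : below p (some (P i)) = P '' Set.Ico (i + 1) L := by
      ext v
      simp only [below, hsub, Set.mem_sdiff, Set.mem_singleton_iff]
      constructor
      · rintro ⟨⟨j, hj, rfl⟩, hne⟩
        have : j ≠ i := fun h => hne (h ▸ rfl)
        exact ⟨j, ⟨by have := hj.1; omega, hj.2⟩, rfl⟩
      · rintro ⟨j, hj, rfl⟩
        refine ⟨⟨j, ⟨by have := hj.1; omega, hj.2⟩, rfl⟩, fun h => ?_⟩
        have := hinj ⟨Nat.zero_le _, hj.2⟩ ⟨Nat.zero_le _, by omega⟩ h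
        have := hj.1
        omega
    obtain ⟨v, hv, hvs⟩ : Hangs p (P '' Set.Ico (i + 1) L) (some (P i)) :=
      hf.hangs_of_component hbelow.ge ⟨_, i + 1, ⟨le_rfl, hi⟩, rfl⟩
        (fun a _ b hb _ => hbelow ▸ hb) (h.path_connected (i + 1))
    -- The child is some later `P j` adjacent to `P i`; since the path is induced, `j = i + 1`.
    obtain ⟨j, hj, rfl⟩ : v ∈ P '' Set.Ico (i + 1) L := hvs ▸ IsAncestor.refl p v
    obtain rfl := h.induced i j hj.1 hj.2 (hf.adj _ _ hv)
    exact ⟨hv, hvs⟩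
  have hall : ∀ i, i < L → subtree p (P i) = P '' Set.Ico i L := by
    intro i
    induction i with
    | zero => exact fun _ => h0
    | succ i ih => exact fun hi => (key i hi (ih (by omega))).2
  exact (key i hi (hall i (by omega))).1

theorem card_sq_le_visitCost [Fintype V] (hK : ∀ a ∈ K, ∀ b ∈ K, a ≠ b → G.Adj a b) :
    K.card ^ 2 ≤ visitCost G K := by
  classical
  have h : ∀ v ∈ K, K.card ≤ 1 + (G.neighborSet v).ncard := by
    intro v hv
    have hsub : ((K.erase v : Finset V) : Set V) ⊆ G.neighborSet v := fun w hw => by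
      have := Finset.mem_erase.1 (Finset.mem_coe.1 hw)
      exact hK v hv w this.2 this.1.symm
    have h1 := Set.ncard_le_ncard hsub
    rw [Set.ncard_coe_finset, Finset.card_erase_of_mem hv] at h1
    omega
  calc K.card ^ 2 = ∑ v ∈ K, K.card := by simp [sq]
    _ ≤ ∑ v ∈ K, (1 + (G.neighborSet v).ncard) := Finset.sum_le_sum h
    _ = visitCost G K := by
      rw [visitCost, ← Finset.sum_indicator_subset _ (Finset.subset_univ K)]

theorem Hangs.notMem_of_isAncestor {z : Option V} (h : Hangs p S z) {u b : V}
    (hu : IsAncestor p u b) (hb : b ∉ S) : u ∉ S := by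
  obtain ⟨v, -, rfl⟩ := h
  exact fun hv => hb (IsAncestor.trans hv hu)

theorem Hangs.parent_of_singleton {z : Option V} {w : V} (h : Hangs p {w} z) : p w = z := by
  obtain ⟨v, hv, hw⟩ := h
  have : v ∈ ({w} : Set V) := hw ▸ IsAncestor.refl p v
  exact Set.mem_singleton_iff.1 this ▸ hv

/-! ### One phase of the bad sequence -/

/-- The vertices of a phase: a path `P`, a clique `K`, a set `W` of leaves, and two vertices `b`,
`c`, all distinct. -/
structure Layout (b c : V) (P : ℕ → V) (L : ℕ) (K W : Finset V) : Prop where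
  inj : Set.InjOn P (Set.Ico 0 L)
  bP : b ∉ P '' Set.Ico 0 L
  bK : b ∉ K
  bW : b ∉ W
  cP : c ∉ P '' Set.Ico 0 L
  cK : c ∉ K
  cW : c ∉ W
  PK : ∀ v ∈ K, v ∉ P '' Set.Ico 0 L
  PW : ∀ v ∈ W, v ∉ P '' Set.Ico 0 L
  KW : ∀ v ∈ W, v ∉ K

/-- The state at the beginning of a phase: path and clique hang from `z`, the leaves `W` from `c`,
which is a child of the descendant `b` of `z`. -/
structure PhaseStart (G : SimpleGraph V) (p : V → Option V) (z : Option V) (b c : V)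
    (P : ℕ → V) (L : ℕ) (K W : Finset V) : Prop where
  forest : IsDFSForest G p
  graph : IsPathAndClique G P L K
  hangsP : Hangs p (P '' Set.Ico 0 L) z
  hangsK : Hangs p K z
  top : ∃ u, p u = z ∧ IsAncestor p u b
  parent : p c = some b
  leaf : ∀ w ∈ W, Hangs p {w} (some c)

/-- The state before the edge `(P i, d)` is inserted: the path hangs from `b`, and the clique, which
contains `d`, from the vertex before `P i`. -/
structure Descent (G : SimpleGraph V) (p : V → Option V) (b c d : V) (P : ℕ → V) (L h : ℕ)
    (K K' W : Finset V) (i : ℕ) : Prop where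
  forest : IsDFSForest G p
  graph : IsPathAndClique G P L K'
  clique : ∀ a ∈ K, ∀ b ∈ K, a ≠ b → G.Adj a b
  path : ∀ k, k + 1 < L → p (P (k + 1)) = some (P k)
  top : p (P 0) = some b
  sub : subtree p (P 0) = P '' Set.Ico 0 L ∪ (if i = 0 then ∅ else (K : Set V))
  next : i < h → ∃ z u, p u = z ∧ Hangs p K z ∧ IsAncestor p u (P i) ∧ u ∉ K ∧
    K.card < (subtree p u).ncard
  parent : p c = some b
  leaf : ∀ w ∈ W, Hangs p {w} (some c)

/-- A state in which the leaves `W` hang from `z₀` and are to be moved below its child `u`, which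
has the larger subtree, while path and clique hang from `z`. -/
structure LeafStage (G : SimpleGraph V) (p : V → Option V) (z₀ z : Option V) (u : V) (P : ℕ → V)
    (L : ℕ) (K W : Finset V) : Prop where
  forest : IsDFSForest G p
  graph : IsPathAndClique G P L K
  hangsP : Hangs p (P '' Set.Ico 0 L) z
  hangsK : Hangs p K z
  parent : p u = z₀
  large : 1 < (subtree p u).ncard
  leaf : ∀ w ∈ W, Hangs p {w} z₀

variable {b c d : V} {z z₀ : Option V} {h t : ℕ}

/-! ### Transitions between the states of a phase -/

theorem ncard_subtree_ge [Fintype V] (hcW : c ∉ W) (hleaf : ∀ w ∈ W, Hangs p {w} (some c)) {u : V}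
    (hu : IsAncestor p u c) : W.card + 1 ≤ (subtree p u).ncard := by
  classical
  have hsub : ((insert c W : Finset V) : Set V) ⊆ subtree p u := by
    intro v hv
    rcases Finset.mem_insert.1 (Finset.mem_coe.1 hv) with rfl | hv
    · exact hu
    · exact hu.trans (.of_parent (hleaf v hv).parent_of_singleton)
  have := Set.ncard_le_ncard hsub
  rwa [Set.ncard_coe_finset, Finset.card_insert_of_notMem hcW] at this

theorem ncard_path_le (P : ℕ → V) (L : ℕ) : (P '' Set.Ico 0 L).ncard ≤ L := by
  refine (Set.ncard_image_le (Set.finite_Ico 0 L)).trans ?_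
  rw [← Finset.coe_Ico, Set.ncard_coe_finset, Nat.card_Ico, Nat.sub_zero]

theorem isAncestor_path (hp : ∀ k, k + 1 < L → p (P (k + 1)) = some (P k)) {i j : ℕ}
    (hij : i ≤ j) (hj : j < L) : IsAncestor p (P i) (P j) := by
  induction j, hij using Nat.le_induction with
  | base => exact .refl _ _
  | succ j _ ih => exact (ih (by omega)).trans (.of_parent (hp j hj))

/-- The child of `z` above `b` carries all the leaves and outweighs the path, so the path moves.
Rebuilt from `P 0`, it becomes a tree path in the right direction. -/
theorem PhaseStart.pull [Fintype V] [DecidableEq V] (hs : PhaseStart G p z b c P L K W)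
    (hl : Layout b c P L K W) (hL : 0 < L) (hW : L + K.card < W.card + 1) :
    Ensures (fun G p => Descent G p b c d P L h K (K.erase d) W 0) G p [s(b, P 0)] 0 := by
  obtain ⟨u, hu, hub⟩ := hs.top
  have huP := hs.hangsP.notMem_of_isAncestor hub hl.bP
  have huK := hs.hangsK.notMem_of_isAncestor hub hl.bK
  have h0 : P 0 ∈ P '' Set.Ico 0 L := ⟨0, ⟨le_rfl, hL⟩, rfl⟩
  have huc := hub.trans (.of_parent hs.parent)
  have hcard := ncard_subtree_ge hl.cW hs.leaf huc
  have hPL := ncard_path_le P L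
  refine .cons (N := 0) (hs.forest.not_adj_of_hangs hs.hangsP h0 hu hub huP) fun p' t ht =>
    ⟨Nat.zero_le _, .nil ?_⟩
  obtain ⟨hR, -⟩ := ht.rehung hs.forest hs.hangsP h0 hu hub huP (by omega)
  have hf := ht.isDFSForest hs.forest
  have hg : IsPathAndClique (addEdge G s(b, P 0)) P L K := hs.graph.addEdge hl.bP hl.bK
  have hKP : Disjoint (K : Set V) (P '' Set.Ico 0 L) :=
    Set.disjoint_left.2 fun v hv => hl.PK v hv
  have hc : p' c = some b := (hR.off c hl.cP).trans hs.parent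
  have hleaf : ∀ w ∈ W, Hangs p' {w} (some c) := fun w hw =>
    hR.hangs_of_disjoint (hs.leaf w hw) (fun h => hl.bW (h ▸ hw))
      (Set.disjoint_singleton_left.2 (hl.PW w hw))
  have hub' : IsAncestor p' u b := (hR.isAncestor_off hl.bP).2 hub
  refine ⟨hf, hg.subset (K.erase_subset d), hg.clique, hf.parent_path hg hl.inj hR.subtree_root,
    hR.parent, by simpa using hR.subtree_root, fun _ => ⟨z, u, (hR.off u huP).trans hu,
      hR.hangs_of_disjoint hs.hangsK hl.bK hKP, hub'.trans (.of_parent hR.parent), huK, ?_⟩,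
    hc, hleaf⟩
  have := ncard_subtree_ge hl.cW hleaf (hub'.trans (.of_parent hc))
  omega

/-- The rival of the clique is a subtree containing `c` and the leaves if `i = 0`, and later the
rest of the path from `P i` on, which is longer than the clique by `hL`. So the clique is rebuilt
each time. -/
theorem Descent.step [Fintype V] [DecidableEq V] {i : ℕ}
    (hs : Descent G p b c d P L h K (K.erase d) W i)
    (hl : Layout b c P L K W) (hd : d ∈ K) (hi : i < h) (hL : h + K.card < L) :
    (s(P i, d) ∉ G.edgeSet ∧ ¬ s(P i, d).IsDiag) ∧ ∀ p' t, SDFS3Insert G p s(P i, d) p' t →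
      K.card ^ 2 ≤ t ∧
      Descent (addEdge G s(P i, d)) p' b c d P L h K (K.erase d) W (i + 1) := by
  obtain ⟨z, u, hu, hK, hui, huK, hcard⟩ := hs.next hi
  refine ⟨hs.forest.not_adj_of_hangs hK hd hu hui huK, fun p' t ht => ?_⟩
  obtain ⟨hR, hcost⟩ := ht.rehung hs.forest hK hd hu hui huK (by rwa [Set.ncard_coe_finset])
  have hPK : ∀ k < L, P k ∉ (K : Set V) := fun k hk h =>
    hl.PK _ h ⟨k, ⟨Nat.zero_le _, hk⟩, rfl⟩
  have hclique : ∀ a ∈ K, ∀ b ∈ K, a ≠ b → (addEdge G s(P i, d)).Adj a b := fun a ha b hb hab =>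
    le_addEdge _ (hs.clique a ha b hb hab)
  have hpath : ∀ k, k + 1 < L → p' (P (k + 1)) = some (P k) := fun k hk =>
    (hR.off _ (hPK _ hk)).trans (hs.path k hk)
  refine ⟨(card_sq_le_visitCost hclique).trans hcost, ht.isDFSForest hs.forest, ?_, hclique,
    hpath, (hR.off _ (hPK 0 (by omega))).trans hs.top, ?_, fun hi' => ?_,
    (hR.off c hl.cK).trans hs.parent, fun w hw => ?_⟩
  · rw [Sym2.eq_swap]
    exact hs.graph.addEdge (hl.PK d hd) (Finset.notMem_erase d K)
  · rw [hR.subtree_of_mem (hPK 0 (by omega)) (isAncestor_path hs.path (Nat.zero_le i) (by omega)),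
      hs.sub]
    by_cases h0 : i = 0 <;> simp [h0]
  · refine ⟨some (P i), P (i + 1), hpath i (by omega), hR.hangs, .refl _ _, hPK _ (by omega), ?_⟩
    have hsub : P '' Set.Ico (i + 1) L ⊆ subtree p' (P (i + 1)) := by
      rintro _ ⟨k, hk, rfl⟩
      exact isAncestor_path hpath hk.1 hk.2
    have h1 := Set.ncard_le_ncard hsub
    rw [(hl.inj.mono (Set.Ico_subset_Ico_left (Nat.zero_le _))).ncard_image,
      ← Finset.coe_Ico, Set.ncard_coe_finset, Nat.card_Ico] at h1
    omega
  · refine hR.hangs_of_disjoint (hs.leaf w hw) (fun h => ?_)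
      (Set.disjoint_singleton_left.2 (hl.KW w hw))
    exact hl.PW w hw ⟨i, ⟨Nat.zero_le _, by omega⟩, h⟩

theorem Descent.loop [Fintype V] [DecidableEq V] {i k : ℕ}
    (hs : Descent G p b c d P L h K (K.erase d) W i)
    (hl : Layout b c P L K W) (hd : d ∈ K) (hi : i + k ≤ h) (hL : h + K.card < L) :
    Ensures (fun G p => Descent G p b c d P L h K (K.erase d) W (i + k)) G p
      ((List.range' i k).map fun i => s(P i, d)) (k * K.card ^ 2) := by
  induction k generalizing i G p with
  | zero => rw [Nat.zero_mul]; exact .nil hs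
  | succ k ih =>
    obtain ⟨h1, h2⟩ := hs.step hl hd (by omega) hL
    rw [Nat.succ_mul, Nat.add_comm (k * _)]
    refine .cons h1 fun p' t ht => ⟨(h2 p' t ht).1, ?_⟩
    refine (ih (h2 p' t ht).2 (by omega)).mono (fun _ _ h => ?_) le_rfl
    rwa [show i + (k + 1) = i + 1 + k by omega]

/-- The leaves make `T(c)` heavier than its sibling `T(P 0)`, which by now consists of path and
clique. With `d` as its new root, path and `K.erase d` have no edge between them and become sibling
subtrees. -/
theorem Descent.lower [Fintype V] [DecidableEq V]
    (hs : Descent G p b c d P L h K (K.erase d) W h)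
    (hl : Layout b c P L K W) (hd : d ∈ K) (hh : 0 < h) (hK : 1 < K.card) (hL : 0 < L)
    (hW : L + K.card < W.card + 1) :
    Ensures (fun G p => LeafStage G p (some c) (some d) d P L (K.erase d) W) G p [s(c, d)] 0 := by
  have hsub : subtree p (P 0) = P '' Set.Ico 0 L ∪ K := by rw [hs.sub, if_neg hh.ne']
  have hH : Hangs p (P '' Set.Ico 0 L ∪ K) (some b) := ⟨P 0, hs.top, hsub⟩
  have hdS : d ∈ P '' Set.Ico 0 L ∪ (K : Set V) := .inr hd
  have hcS : c ∉ P '' Set.Ico 0 L ∪ (K : Set V) := fun h => h.elim hl.cP hl.cK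
  have hcard : (P '' Set.Ico 0 L ∪ (K : Set V)).ncard < (subtree p c).ncard := by
    have h1 := ncard_subtree_ge hl.cW hs.leaf (.refl p c)
    have h2 := Set.ncard_union_le (P '' Set.Ico 0 L) (K : Set V)
    have h3 := ncard_path_le P L
    rw [Set.ncard_coe_finset] at h2
    omega
  refine .cons (N := 0) (hs.forest.not_adj_of_hangs hH hdS hs.parent (.refl p c) hcS) fun p' t ht =>
    ⟨Nat.zero_le _, .nil ?_⟩
  obtain ⟨hR, -⟩ := ht.rehung hs.forest hH hdS hs.parent (.refl p c) hcS hcard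
  have hf := ht.isDFSForest hs.forest
  have hg : IsPathAndClique (addEdge G s(c, d)) P L (K.erase d) :=
    hs.graph.addEdge hl.cP fun h => hl.cK (Finset.mem_of_mem_erase h)
  have hbelow : below p' (some d) = P '' Set.Ico 0 L ∪ ((K.erase d : Finset V) : Set V) := by
    have := hl.PK d hd
    ext v
    simp only [below, hR.subtree_root, Set.mem_sdiff, Set.mem_union, Set.mem_singleton_iff,
      Finset.coe_erase, Finset.mem_coe]
    constructor
    · rintro ⟨h1 | h1, h2⟩
      · exact .inl h1
      · exact .inr ⟨h1, h2⟩
    · rintro (h1 | h1)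
      · exact ⟨.inl h1, fun h2 => this (h2 ▸ h1)⟩
      · exact ⟨.inr h1.1, h1.2⟩
  refine ⟨hf, hg, ?_, ?_, hR.parent, ?_, fun w hw => ?_⟩
  · refine hf.hangs_of_component (hbelow ▸ Set.subset_union_left) ⟨P 0, 0, ⟨le_rfl, hL⟩, rfl⟩ ?_
      (hg.path_connected 0)
    rintro _ ⟨i, hi, rfl⟩ v hv hadj
    rw [hbelow] at hv
    exact hv.resolve_right fun h => hg.sep i hi.2 v h hadj
  · refine hf.hangs_of_component (hbelow ▸ Set.subset_union_right) ?_ ?_ hg.clique_connected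
    · rw [Finset.coe_nonempty, ← Finset.card_pos, Finset.card_erase_of_mem hd]
      omega
    · intro a ha v hv hadj
      rw [hbelow] at hv
      refine hv.resolve_left ?_
      rintro ⟨i, hi, rfl⟩
      exact hg.sep i hi.2 a ha hadj.symm
  · rw [hR.subtree_root]
    refine hK.trans_le ?_
    rw [← Set.ncard_coe_finset]
    exact Set.ncard_le_ncard Set.subset_union_right
  · exact hR.hangs_of_disjoint (hs.leaf w hw) (fun h => hl.cW (h ▸ hw))
      (Set.disjoint_singleton_left.2 fun h => h.elim (hl.PW w hw) (hl.KW w hw))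

theorem LeafStage.move [Fintype V] [DecidableEq V] {u x w : V}
    (hs : LeafStage G p z₀ z u P L K W)
    (hx : IsAncestor p u x) (hxP : x ∉ P '' Set.Ico 0 L) (hxK : x ∉ K) (hxW : x ∉ W)
    (hw : w ∈ W) (hwP : w ∉ P '' Set.Ico 0 L) (hwK : w ∉ K) :
    (s(x, w) ∉ G.edgeSet ∧ ¬ s(x, w).IsDiag) ∧ ∀ p' t, SDFS3Insert G p s(x, w) p' t →
      LeafStage (addEdge G s(x, w)) p' z₀ z u P L K (W.erase w) ∧ Rehung p p' {w} x w := by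
  have huw : u ∉ ({w} : Set V) :=
    (hs.leaf w hw).notMem_of_isAncestor hx fun h => hxW (Set.mem_singleton_iff.1 h ▸ hw)
  have hcard : ({w} : Set V).ncard < (subtree p u).ncard := by
    rw [Set.ncard_singleton]
    exact hs.large
  refine ⟨hs.forest.not_adj_of_hangs (hs.leaf w hw) rfl hs.parent hx huw, fun p' t ht => ?_⟩
  obtain ⟨hR, -⟩ := ht.rehung hs.forest (hs.leaf w hw) rfl hs.parent hx huw hcard
  refine ⟨⟨ht.isDFSForest hs.forest, hs.graph.addEdge hxP hxK,
    hR.hangs_of_disjoint hs.hangsP hxP (Set.disjoint_singleton_right.2 hwP),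
    hR.hangs_of_disjoint hs.hangsK hxK (Set.disjoint_singleton_right.2 hwK),
    (hR.off u huw).trans hs.parent, ?_, fun v hv => ?_⟩, hR⟩
  · rw [hR.subtree_of_mem huw hx]
    exact hs.large.trans_le (Set.ncard_le_ncard Set.subset_union_left)
  · obtain ⟨hvw, hv⟩ := Finset.mem_erase.1 hv
    exact hR.hangs_of_disjoint (hs.leaf v hv) (fun h => hxW (Set.mem_singleton_iff.1 h ▸ hv))
      (Set.disjoint_singleton.2 hvw)

/-- Moving all the leaves to a descendant `x` of `u`. -/
theorem LeafStage.loop [Fintype V] [DecidableEq V] {b e u x : V} {D : Finset V} {l : List V}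
    (hs : LeafStage G p z₀ z u P L K l.toFinset) (hl : l.Nodup) (he : p e = z)
    (heb : IsAncestor p e b) (hux : IsAncestor p u x) (hx : p x = some b)
    (hxP : x ∉ P '' Set.Ico 0 L) (hxK : x ∉ K) (hxl : x ∉ l) (hbl : b ∉ l)
    (hP : ∀ w ∈ l, w ∉ P '' Set.Ico 0 L) (hK : ∀ w ∈ l, w ∉ K)
    (hD : ∀ w ∈ D, w ∉ l ∧ w ≠ x ∧ Hangs p {w} (some x)) :
    Ensures (fun G p => PhaseStart G p z b x P L K (D ∪ l.toFinset)) G p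
      (l.map fun w => s(x, w)) 0 := by
  induction l generalizing G p D with
  | nil =>
    refine .nil ⟨hs.forest, hs.graph, hs.hangsP, hs.hangsK, ⟨e, he, heb⟩, hx, ?_⟩
    simpa using fun w hw => (hD w hw).2.2
  | cons w l ih =>
    obtain ⟨hwl, hl⟩ := List.nodup_cons.1 hl
    simp only [List.mem_cons, not_or, forall_eq_or_imp] at hxl hbl hP hK hD
    obtain ⟨h1, h2⟩ := hs.move hux hxP hxK (by simpa using hxl) (by simp) hP.1 hK.1
    refine .cons (N := 0) (M := 0) h1 fun p' t ht => ⟨Nat.zero_le _, ?_⟩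
    obtain ⟨h3, hR⟩ := h2 p' t ht
    have hew := (hs.leaf w (by simp)).notMem_of_isAncestor heb hbl.1
    have hlw : (w :: l).toFinset.erase w = l.toFinset := by
      ext v
      simp only [List.toFinset_cons, Finset.mem_erase, Finset.mem_insert, List.mem_toFinset]
      exact ⟨fun h => h.2.resolve_left h.1, fun h => ⟨fun h' => hwl (h' ▸ h), .inr h⟩⟩
    rw [hlw] at h3
    -- `D` collects the leaves that already hang from `x`.
    refine (ih (D := insert w D) h3 hl ((hR.off e hew).trans he) ((hR.isAncestor_off hbl.1).2 heb)
      ((hR.isAncestor_off hxl.1).2 hux) ((hR.off x hxl.1).trans hx)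
      hxl.2 hbl.2 hP.2 hK.2 ?_).mono (fun G p h => ?_) le_rfl
    · intro v hv
      rcases Finset.mem_insert.1 hv with rfl | hv
      · exact ⟨hwl, fun h => hxl.1 h.symm, hR.hangs⟩
      · obtain ⟨⟨h4, h5⟩, h6, h7⟩ := hD v hv
        exact ⟨h5, h6, hR.hangs_of_disjoint h7 (fun h => h6 h.symm)
          (Set.disjoint_singleton.2 h4)⟩
    · rwa [show D ∪ (w :: l).toFinset = insert w D ∪ l.toFinset by simp]

/-- A phase: `h` insertions that rebuild the clique, after which the leaves are moved so that the
next phase can begin. -/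
theorem exists_phase [Fintype V] [DecidableEq V] (hl : Layout b c P L K W) (hh : 0 < h)
    (hK : 1 < K.card) (hL : h + K.card < L) (hW : L + K.card < W.card + 1) :
    ∃ (es : List (Sym2 V)) (d b' c' : V) (K' W' : Finset V), Layout b' c' P L K' W' ∧
      K'.card + 1 = K.card ∧ W'.card + 2 = W.card ∧ es.length = h + W.card + 2 ∧
      ∀ G p z, PhaseStart G p z b c P L K W →
        Ensures (fun G' p' => PhaseStart G' p' (some d) b' c' P L K' W') G p es
          (h * K.card ^ 2) := by
  obtain ⟨d, hd⟩ : K.Nonempty := Finset.card_pos.1 (by omega)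
  obtain ⟨b', hb, c', hc, hbc⟩ := Finset.one_lt_card.1 (show 1 < W.card by omega)
  set W' := (W.erase b').erase c' with hW'
  have hcE : c' ∈ W.erase b' := Finset.mem_erase.2 ⟨hbc.symm, hc⟩
  have hWW : W' ⊆ W := (Finset.erase_subset _ _).trans (Finset.erase_subset _ _)
  have hcard : W'.card + 2 = W.card := by
    rw [hW', Finset.card_erase_of_mem hcE, Finset.card_erase_of_mem hb]
    omega
  have hdK : ∀ v, v ∉ K → v ∉ K.erase d := fun v hv h => hv (Finset.mem_of_mem_erase h)
  have hb' : b' ∉ W' := fun h => (Finset.mem_erase.1 (Finset.mem_of_mem_erase h)).1 rfl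
  have hc' : c' ∉ W' := Finset.notMem_erase _ _
  have hdW : d ∉ W := fun h => hl.KW d h hd
  -- Only the middle block is charged for. The edges after `s(c, d)` hang `b'` from `d`, `c'` from
  -- `b'`, and the other leaves from `c'`.
  refine ⟨[s(b, P 0)] ++ ((List.range' 0 h).map (fun i => s(P i, d)) ++ ([s(c, d)] ++
    (s(d, b') :: s(b', c') :: W'.toList.map fun w => s(c', w)))), d, b', c', K.erase d, W',
    ⟨hl.inj, hl.PW b' hb, hdK _ (hl.KW b' hb), hb', hl.PW c' hc, hdK _ (hl.KW c' hc), hc',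
      fun v hv => hl.PK v (Finset.mem_of_mem_erase hv), fun v hv => hl.PW v (hWW hv),
      fun v hv => hdK _ (hl.KW v (hWW hv))⟩,
    Finset.card_erase_add_one hd, hcard, by simp; omega, fun G p z hs => ?_⟩
  rw [show h * K.card ^ 2 = 0 + (h * K.card ^ 2 + (0 + (0 + (0 + 0)))) by omega]
  refine ((hs.pull (d := d) (h := h) hl (by omega) hW).mono (fun G p hs => ?_) le_rfl).append
  refine ((hs.loop (k := h) hl hd (by omega) hL).mono (fun G p hs => ?_) le_rfl).append
  rw [Nat.zero_add] at hs
  refine ((hs.lower hl hd hh hK (by omega) hW).mono (fun G p hs => ?_) le_rfl).append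
  obtain ⟨h1, h2⟩ := hs.move (.refl p d) (hl.PK d hd) (Finset.notMem_erase d K) hdW hb
    (hl.PW b' hb) (hdK _ (hl.KW b' hb))
  refine .cons h1 fun p₁ t ht => ⟨Nat.zero_le _, ?_⟩
  obtain ⟨hs₁, hR₁⟩ := h2 p₁ t ht
  obtain ⟨h3, h4⟩ := hs₁.move (.of_parent hR₁.parent) (hl.PW b' hb) (hdK _ (hl.KW b' hb))
    (Finset.notMem_erase b' W) hcE (hl.PW c' hc) (hdK _ (hl.KW c' hc))
  refine .cons h3 fun p₂ t ht => ⟨Nat.zero_le _, ?_⟩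
  obtain ⟨hs₂, hR₂⟩ := h4 p₂ t ht
  rw [← hW', ← Finset.toList_toFinset W'] at hs₂
  have hb₂ : p₂ b' = some d := (hR₂.off b' hbc).trans hR₁.parent
  refine (hs₂.loop (b := b') (D := ∅) (Finset.nodup_toList _) hb₂ (.refl p₂ b')
    ((IsAncestor.of_parent hb₂).trans (.of_parent hR₂.parent)) hR₂.parent (hl.PW c' hc) (hdK _ (hl.KW c' hc)) (by simpa using hc') (by simpa using hb')
    (fun w hw => hl.PW w (hWW (by simpa using hw)))
    (fun w hw => hdK _ (hl.KW w (hWW (by simpa using hw)))) (by simp)).mono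
    (fun G p h => ?_) le_rfl
  simpa using h

/-- Iterated phases. -/
theorem exists_phases [Fintype V] [DecidableEq V] (q : ℕ) (hl : Layout b c P L K W) (hh : 0 < h)
    (hK : q < K.card) (hL : h + K.card < L) (hW : L + K.card + 2 * q ≤ W.card) :
    ∃ es : List (Sym2 V), es.length ≤ q * (h + W.card + 2) ∧
      ∀ G p z, PhaseStart G p z b c P L K W →
        Ensures (fun _ _ => True) G p es (q * (h * (K.card - q) ^ 2)) := by
  induction q generalizing b c K W with
  | zero => exact ⟨[], by simp, fun G p z _ => by rw [Nat.zero_mul]; exact .nil trivial⟩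
  | succ q ih =>
    obtain ⟨es, d, b', c', K', W', hl', hK', hW', hlen, hes⟩ :=
      exists_phase (h := h) hl hh (by omega) hL (by omega)
    obtain ⟨fs, hflen, hfs⟩ := ih hl' (by omega) (by omega) (by omega)
    refine ⟨es ++ fs, ?_, fun G p z hs => ?_⟩
    · have : q * (h + W'.card + 2) ≤ q * (h + W.card + 2) := Nat.mul_le_mul_left _ (by omega)
      rw [List.length_append, Nat.succ_mul]
      omega
    · have h1 := ((hes G p z hs).mono (fun G p hs => hfs G p _ hs) le_rfl).append
      refine h1.mono (fun _ _ h => h) ?_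
      -- Each phase is charged at the size of the clique after the last phase.
      rw [Nat.succ_mul, Nat.add_comm, show K'.card - q = K.card - (q + 1) by omega]
      gcongr
      omega

/-! ### The initial insertions -/

/-- The disjoint union of the path `P`, the clique `K` and the edge `(q, b)`. -/
def startGraph (q b : V) (P : ℕ → V) (L : ℕ) (K : Finset V) : SimpleGraph V :=
  SimpleGraph.fromRel fun v w => (∃ i, i + 1 < L ∧ v = P i ∧ w = P (i + 1)) ∨
    (v ∈ K ∧ w ∈ K) ∨ (v = q ∧ w = b)

section startGraph

variable {q : V}

theorem startGraph_adj_path (hl : Layout b c P L K W) (hqP : q ∉ P '' Set.Ico 0 L) {i : ℕ}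
    (hi : i < L) {v : V} (hv : (startGraph q b P L K).Adj (P i) v) :
    ∃ j < L, v = P j ∧ (j = i + 1 ∨ i = j + 1) := by
  have hmem : ∀ {j}, j < L → P j ∈ P '' Set.Ico 0 L := fun hj => ⟨_, ⟨Nat.zero_le _, hj⟩, rfl⟩
  have hinj : ∀ {j}, j < L → P i = P j → i = j := fun hj h =>
    hl.inj ⟨Nat.zero_le _, hi⟩ ⟨Nat.zero_le _, hj⟩ h
  obtain ⟨-, (⟨j, hj, h1, h2⟩ | ⟨h1, -⟩ | ⟨h1, -⟩) | (⟨j, hj, h1, h2⟩ | ⟨-, h1⟩ | ⟨-, h1⟩)⟩ :=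
    (SimpleGraph.fromRel_adj _ _ _).1 hv
  · obtain rfl := hinj (by omega) h1
    exact ⟨_, hj, h2, .inl rfl⟩
  · exact (hl.PK _ h1 (hmem hi)).elim
  · exact (hqP (h1 ▸ hmem hi)).elim
  · obtain rfl := hinj hj h2
    exact ⟨j, by omega, h1, .inr rfl⟩
  · exact (hl.PK _ h1 (hmem hi)).elim
  · exact (hl.bP (h1 ▸ hmem hi)).elim

theorem startGraph_adj_clique (hl : Layout b c P L K W) (hqK : q ∉ K) {a v : V} (ha : a ∈ K)
    (hv : (startGraph q b P L K).Adj a v) : v ∈ K := by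
  have hmem : ∀ {j}, j < L → P j ∈ P '' Set.Ico 0 L := fun hj => ⟨_, ⟨Nat.zero_le _, hj⟩, rfl⟩
  obtain ⟨-, (⟨j, hj, h1, h2⟩ | ⟨-, h1⟩ | ⟨h1, -⟩) | (⟨j, hj, h1, h2⟩ | ⟨h1, -⟩ | ⟨-, h1⟩)⟩ :=
    (SimpleGraph.fromRel_adj _ _ _).1 hv
  · exact (hl.PK a ha (h1 ▸ hmem (by omega))).elim
  · exact h1
  · exact (hqK (h1 ▸ ha)).elim
  · exact (hl.PK a ha (h2 ▸ hmem hj)).elim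
  · exact h1
  · exact (hl.bK (h1 ▸ ha)).elim

theorem startGraph_support [DecidableEq V] {v w : V} (hv : (startGraph q b P L K).Adj v w) :
    v ∈ insert q (insert b (K ∪ (Finset.range L).image P)) := by
  obtain ⟨-, (⟨j, hj, h1, h2⟩ | ⟨h1, -⟩ | ⟨h1, -⟩) | (⟨j, hj, h1, h2⟩ | ⟨-, h1⟩ | ⟨-, h1⟩)⟩ :=
    (SimpleGraph.fromRel_adj _ _ _).1 hv
  · simp only [Finset.mem_insert, Finset.mem_union, Finset.mem_image, Finset.mem_range]
    exact .inr (.inr (.inr ⟨j, by omega, h1.symm⟩))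
  · simp [h1]
  · simp [h1]
  · simp only [Finset.mem_insert, Finset.mem_union, Finset.mem_image, Finset.mem_range]
    exact .inr (.inr (.inr ⟨j + 1, hj, h2.symm⟩))
  · simp [h1]
  · simp [h1]

theorem card_edgeSet_startGraph_le [Fintype V] [DecidableEq V] (q b : V) (P : ℕ → V) (L : ℕ)
    (K : Finset V) :
    (startGraph q b P L K).edgeSet.ncard ≤ (L + K.card + 3).choose 2 := by
  set A := insert q (insert b (K ∪ (Finset.range L).image P)) with hA
  have hsub : (startGraph q b P L K).edgeSet ⊆ (A.sym2 : Set (Sym2 V)) := by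
    intro e he
    induction e using Sym2.ind with
    | _ v w =>
      rw [Finset.mem_coe, Finset.mk_mem_sym2_iff]
      exact ⟨startGraph_support he, startGraph_support (SimpleGraph.Adj.symm he)⟩
  have h1 := Set.ncard_le_ncard hsub
  rw [Set.ncard_coe_finset, Finset.card_sym2] at h1
  refine h1.trans (Nat.choose_le_choose 2 ?_)
  have h2 := Finset.card_insert_le q (insert b (K ∪ (Finset.range L).image P))
  have h3 := Finset.card_insert_le b (K ∪ (Finset.range L).image P)
  have h4 := Finset.card_union_le K ((Finset.range L).image P)
  have h5 := Finset.card_image_le (s := Finset.range L) (f := P)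
  rw [Finset.card_range] at h5
  rw [hA]
  omega

theorem isPathAndClique_startGraph (hl : Layout b c P L K W) (hqP : q ∉ P '' Set.Ico 0 L) :
    IsPathAndClique (startGraph q b P L K) P L K := by
  have hinj : ∀ {i j}, i < L → j < L → P i = P j → i = j := fun hi hj h =>
    hl.inj ⟨Nat.zero_le _, hi⟩ ⟨Nat.zero_le _, hj⟩ h
  refine ⟨fun i hi => ?_, fun i j hij hj hadj => ?_, fun a ha b hb hab => ?_,
    fun i hi a ha hadj => ?_⟩
  · refine (SimpleGraph.fromRel_adj _ _ _).2 ⟨fun h => ?_, .inl (.inl ⟨i, hi, rfl, rfl⟩)⟩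
    have := hinj (by omega) hi h
    omega
  · obtain ⟨k, hk, h1, h2⟩ := startGraph_adj_path hl hqP (hij.trans hj) hadj
    have := hinj hj hk h1
    omega
  · exact (SimpleGraph.fromRel_adj _ _ _).2 ⟨hab, .inl (.inr (.inl ⟨ha, hb⟩))⟩
  · obtain ⟨k, hk, h1, -⟩ := startGraph_adj_path hl hqP hi hadj
    exact hl.PK a ha ⟨k, ⟨Nat.zero_le _, hk⟩, h1.symm⟩

end startGraph

theorem IsDFSForest.hangs_of_isolated (hf : IsDFSForest G p) {v : V} (hv : ∀ w, ¬ G.Adj v w) :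
    Hangs p {v} none := by
  refine hf.hangs_of_component (Set.subset_univ _) (Set.singleton_nonempty v) ?_ ?_
  · rintro a rfl w - hw
    exact (hv w hw).elim
  · exact fun T hT hne _ => (Set.subset_singleton_iff_eq.1 hT).resolve_left hne.ne_empty

/-- The beginning of the bad sequence. -/
theorem exists_start [Fintype V] [DecidableEq V] {q : V} (hl : Layout b c P L K W)
    (hqP : q ∉ P '' Set.Ico 0 L) (hqK : q ∉ K) (hqW : q ∉ W) (hqb : q ≠ b) (hqc : q ≠ c)
    (hbc : b ≠ c) (hL : 0 < L) (hK : K.Nonempty) :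
    ∃ es : List (Sym2 V), es.length ≤ (L + K.card + 3).choose 2 + W.card + 1 ∧
      Ensures (fun G p => PhaseStart G p none b c P L K W) ⊥ (fun _ => none) es 0 := by
  classical
  set H := startGraph q b P L K with hH
  have hg : IsPathAndClique H P L K := isPathAndClique_startGraph hl hqP
  refine ⟨H.edgeFinset.toList ++ (s(b, c) :: W.toList.map fun w => s(c, w)), ?_, ?_⟩
  · have h1 := card_edgeSet_startGraph_le q b P L K
    rw [← hH, Set.ncard_eq_toFinset_card'] at h1
    simp only [List.length_append, Finset.length_toList, List.length_cons, List.length_map,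
      SimpleGraph.edgeFinset]
    omega
  refine Ensures.append (N := 0) (M := 0) ((Ensures.of_nodup isDFSForest_bot
    (Finset.nodup_toList _) fun e he => ⟨by simp, ?_⟩).mono ?_ le_rfl)
  · simp only [Finset.mem_toList, SimpleGraph.mem_edgeFinset] at he
    exact H.not_isDiag_of_mem_edgeSet he
  rintro G p ⟨hG, hf⟩
  obtain rfl : G = H := by
    rw [hG]
    simp
  have hP : Hangs p (P '' Set.Ico 0 L) none := by
    refine hf.hangs_of_component (Set.subset_univ _) ⟨P 0, 0, ⟨le_rfl, hL⟩, rfl⟩ ?_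
      (hg.path_connected 0)
    rintro _ ⟨i, hi, rfl⟩ v - hv
    obtain ⟨j, hj, rfl, -⟩ := startGraph_adj_path hl hqP hi.2 hv
    exact ⟨j, ⟨Nat.zero_le _, hj⟩, rfl⟩
  have hKh : Hangs p K none :=
    hf.hangs_of_component (Set.subset_univ _) hK
      (fun a ha v _ hv => startGraph_adj_clique hl hqK ha hv) hg.clique_connected
  have hiso : ∀ v ∈ insert c W, Hangs p {v} none := by
    intro v hv
    refine hf.hangs_of_isolated fun w hw => ?_
    have h1 := startGraph_support hw
    have himg : v ∈ (Finset.range L).image P → v ∈ P '' Set.Ico 0 L := by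
      intro h
      obtain ⟨i, hi, rfl⟩ := Finset.mem_image.1 h
      exact ⟨i, ⟨Nat.zero_le _, Finset.mem_range.1 hi⟩, rfl⟩
    simp only [Finset.mem_insert, Finset.mem_union] at h1 hv
    rcases hv with rfl | hv
    · rcases h1 with h1 | h1 | h1 | h1
      · exact hqc h1.symm
      · exact hbc h1.symm
      · exact hl.cK h1
      · exact hl.cP (himg h1)
    · rcases h1 with rfl | rfl | h1 | h1
      · exact hqW hv
      · exact hl.bW hv
      · exact hl.KW v hv h1
      · exact hl.PW v hv (himg h1)
  have hqbadj : H.Adj q b :=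
    (SimpleGraph.fromRel_adj _ _ _).2 ⟨hqb, .inl (.inr (.inr ⟨rfl, rfl⟩))⟩
  -- The edge `(q, b)` serves only this purpose: the tree of `b` has two vertices, so single
  -- vertices are strictly smaller and get hung below `b`.
  obtain ⟨u, hu, hub, hularge⟩ : ∃ u, p u = none ∧ IsAncestor p u b ∧
      1 < (subtree p u).ncard := by
    rcases hf.comp q b hqbadj with h | h
    · obtain ⟨r, hr, hrq⟩ := hf.rooted q
      refine ⟨r, hr, hrq.trans h, ?_⟩
      have := Set.ncard_le_ncard (show ({q, b} : Set V) ⊆ subtree p r from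
        Set.insert_subset hrq (Set.singleton_subset_iff.2 (hrq.trans h)))
      rw [Set.ncard_pair hqb] at this
      omega
    · obtain ⟨r, hr, hrb⟩ := hf.rooted b
      refine ⟨r, hr, hrb, ?_⟩
      have := Set.ncard_le_ncard (show ({q, b} : Set V) ⊆ subtree p r from
        Set.insert_subset (hrb.trans h) (Set.singleton_subset_iff.2 hrb))
      rw [Set.ncard_pair hqb] at this
      omega
  have hs : LeafStage H p none none u P L K (insert c W) :=
    ⟨hf, hg, hP, hKh, hu, hularge, hiso⟩
  obtain ⟨h1, h2⟩ := hs.move hub hl.bP hl.bK (by simp [hbc, hl.bW]) (by simp) hl.cP hl.cK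
  refine .cons (N := 0) (M := 0) h1 fun p₁ t ht => ⟨Nat.zero_le _, ?_⟩
  obtain ⟨hs₁, hR⟩ := h2 p₁ t ht
  rw [Finset.erase_insert hl.cW, ← Finset.toList_toFinset W] at hs₁
  have hub₁ : IsAncestor p₁ u b := (hR.isAncestor_off hbc).2 hub
  refine (hs₁.loop (D := ∅) (Finset.nodup_toList _) hs₁.parent hub₁
    (hub₁.trans (.of_parent hR.parent)) hR.parent hl.cP hl.cK (by simpa using hl.cW)
    (by simpa using hl.bW) (fun w hw => hl.PW w (by simpa using hw))
    (fun w hw => hl.KW w (by simpa using hw)) (by simp)).mono (fun G p h => ?_) le_rfl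
  simpa using h

/-! ### The whole sequence -/

/-- On `12 N + 5` or more vertices, `O(N ^ 2)` insertions can force `N ^ 4` steps. -/
theorem exists_bad_sequence {n N : ℕ} (hN : 0 < N) (hn : 12 * N + 5 ≤ n) :
    ∃ es : List (Sym2 (Fin n)), es.length ≤ 200 * N ^ 2 ∧
      Ensures (fun _ _ => True) ⊥ (fun _ => none) es (N ^ 4) := by
  classical
  set f : ℕ → Fin n := fun i => if hi : i < n then ⟨i, hi⟩ else ⟨0, by omega⟩ with hf
  have hinj : ∀ {i j}, i < n → j < n → f i = f j → i = j := by
    intro i j hi hj h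
    simpa [hf, hi, hj] using h
  have hinjOn : ∀ a b, b ≤ n → Set.InjOn f (Finset.Ico a b : Finset ℕ) := by
    intro a b hb i hi j hj h
    rw [Finset.coe_Ico] at hi hj
    exact hinj (hi.2.trans_le hb) (hj.2.trans_le hb) h
  -- With `h = N` and N phases, `|K| = 2N` keeps the clique at N or more vertices, `L > h + |K|`,
  -- and `|W| = L + |K| + 2N` leaves enough weight although each phase uses two leaves. Together
  -- with `b`, `c`, `q` these are `12N + 5` vertices.
  set L := 3 * N + 1 with hL
  set K := (Finset.Ico L (L + 2 * N)).image f with hK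
  set W := (Finset.Ico (L + 2 * N) (L + 2 * N + (7 * N + 1))).image f with hW
  have hKc : K.card = 2 * N := by
    rw [hK, Finset.card_image_of_injOn (hinjOn _ _ (by omega)), Nat.card_Ico]
    omega
  have hWc : W.card = 7 * N + 1 := by
    rw [hW, Finset.card_image_of_injOn (hinjOn _ _ (by omega)), Nat.card_Ico]
    omega
  have hPm : ∀ {i}, i < n → f i ∈ f '' Set.Ico 0 L → i < L := by
    rintro i hi ⟨j, hj, h⟩
    have := hinj (by have := hj.2; omega) hi h
    exact this ▸ hj.2
  have hKm : ∀ {i}, i < n → f i ∈ K → L ≤ i ∧ i < L + 2 * N := by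
    intro i hi h
    obtain ⟨j, hj, h⟩ := Finset.mem_image.1 h
    rw [Finset.mem_Ico] at hj
    exact hinj (by omega) hi h ▸ hj
  have hWm : ∀ {i}, i < n → f i ∈ W → L + 2 * N ≤ i ∧ i < L + 2 * N + (7 * N + 1) := by
    intro i hi h
    obtain ⟨j, hj, h⟩ := Finset.mem_image.1 h
    rw [Finset.mem_Ico] at hj
    exact hinj (by omega) hi h ▸ hj
  have hl : Layout (f (12 * N + 2)) (f (12 * N + 3)) f L K W := by
    refine ⟨fun i hi j hj h => hinj (by have := hi.2; omega) (by have := hj.2; omega) h,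
      fun h => ?_, fun h => ?_, fun h => ?_, fun h => ?_, fun h => ?_, fun h => ?_,
      fun v hv h => ?_, fun v hv h => ?_, fun v hv h => ?_⟩
    · have := hPm (by omega) h; omega
    · have := hKm (by omega) h; omega
    · have := hWm (by omega) h; omega
    · have := hPm (by omega) h; omega
    · have := hKm (by omega) h; omega
    · have := hWm (by omega) h; omega
    · obtain ⟨i, hi, rfl⟩ := Finset.mem_image.1 hv
      rw [Finset.mem_Ico] at hi
      have := hPm (by omega) h; omega
    · obtain ⟨i, hi, rfl⟩ := Finset.mem_image.1 hv
      rw [Finset.mem_Ico] at hi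
      have := hPm (by omega) h; omega
    · obtain ⟨i, hi, rfl⟩ := Finset.mem_image.1 hv
      rw [Finset.mem_Ico] at hi
      have := hKm (by omega) h; omega
  obtain ⟨es, hes, hE⟩ := exists_start (q := f (12 * N + 4)) hl
    (fun h => by have := hPm (by omega) h; omega) (fun h => by have := hKm (by omega) h; omega)
    (fun h => by have := hWm (by omega) h; omega)
    (fun h => by have := hinj (by omega) (by omega) h; omega)
    (fun h => by have := hinj (by omega) (by omega) h; omega)
    (fun h => by have := hinj (by omega) (by omega) h; omega)
    (by omega) (Finset.card_pos.1 (by omega))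
  obtain ⟨fs, hfs, hF⟩ := exists_phases (h := N) N hl hN (by omega) (by omega) (by omega)
  refine ⟨es ++ fs, ?_, ?_⟩
  · have h1 : (L + K.card + 3).choose 2 ≤ (L + K.card + 3) ^ 2 := Nat.choose_le_pow _ _
    rw [hKc] at hes h1
    rw [hWc] at hes hfs
    rw [List.length_append]
    have h2 : (L + 2 * N + 3) ^ 2 ≤ (9 * N) ^ 2 := Nat.pow_le_pow_left (by omega) 2
    have h3 : N * (N + (7 * N + 1) + 2) ≤ N * (11 * N) := Nat.mul_le_mul_left _ (by omega)
    have h4 : 7 * N + 1 + 1 ≤ 8 * N ^ 2 + 1 := by nlinarith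
    nlinarith
  · refine (hE.mono (fun G p h => hF G p _ h) le_rfl).append.mono (fun _ _ h => h) ?_
    rw [hKc, show 2 * N - N = N by omega]
    exact le_of_eq (by ring)

/-- New edges can be appended to a sequence of insertions. -/
theorem exists_insertionSeq_append {n m : ℕ} {es : List (Sym2 (Fin n))} (hes : es.Nodup)
    (hd : ∀ e ∈ es, ¬ e.IsDiag) (hlen : es.length ≤ m) (hm : m ≤ n.choose 2) :
    ∃ fs, IsInsertionSeq m (es ++ fs) := by
  classical
  set A := (⊤ : SimpleGraph (Fin n)).edgeFinset with hA
  have hAm : ∀ e, e ∈ A ↔ ¬ e.IsDiag := fun e => by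
    simp [hA]
  have hAc : A.card = n.choose 2 := by
    rw [hA, SimpleGraph.card_edgeFinset_top_eq_card_choose_two, Fintype.card_fin]
  have hsub : es.toFinset ⊆ A := fun e he => (hAm e).2 (hd e (List.mem_toFinset.1 he))
  obtain ⟨B, hesB, hBA, hB⟩ := Finset.exists_subsuperset_card_eq hsub
    (by rwa [List.toFinset_card_of_nodup hes]) (hm.trans_eq hAc.symm)
  refine ⟨(B \ es.toFinset).toList, ?_, ?_, ?_⟩
  · rw [List.length_append, Finset.length_toList, Finset.card_sdiff_of_subset hesB, hB,
      List.toFinset_card_of_nodup hes]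
    omega
  · refine List.nodup_append.2 ⟨hes, Finset.nodup_toList _, fun a ha b hb hab => ?_⟩
    subst hab
    simp only [Finset.mem_toList, Finset.mem_sdiff, List.mem_toFinset] at hb
    exact hb.2 ha
  · intro e he
    rcases List.mem_append.1 he with he | he
    · exact hd e he
    · simp only [Finset.mem_toList, Finset.mem_sdiff] at he
      exact (hAm e).1 (hBA he.1)

/-- There is a sequence of `m` insertions on which SDFS3 takes at least `m ^ 2 / 2560000` steps. -/
theorem exists_insertionSeq {n m : ℕ} (hm : m ≤ n.choose 2) :
    ∃ es : List (Sym2 (Fin n)), IsInsertionSeq m es ∧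
      ∀ t, SDFS3Takes es t → m ^ 2 ≤ 2560000 * t := by
  -- For `N ≥ 1`, `200 N^2 ≤ (20N)^2 ≤ k^2 ≤ m` makes room for the bad sequence, and `k + 1 ≤ 40N`
  -- gives `m ≤ 1600 N^2`; the constant is `1600^2`.
  set k := m.sqrt with hk
  set N := k / 20 with hN
  have hkm : k * k ≤ m := Nat.sqrt_le m
  have hmk : m < (k + 1) * (k + 1) := Nat.lt_succ_sqrt m
  -- If `N = 0` then `m < 400`, and one step per insertion is enough.
  rcases Nat.eq_zero_or_pos N with h0 | hpos
  · obtain ⟨fs, hfs⟩ := exists_insertionSeq_append (es := []) List.nodup_nil (by simp)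
      (Nat.zero_le m) hm
    refine ⟨fs, hfs, fun t ht => ?_⟩
    have h1 := SDFS3Run.length_le ht
    rw [show fs.length = m from hfs.1] at h1
    have h2 : k + 1 ≤ 20 := by omega
    have h3 : (k + 1) * (k + 1) ≤ 20 * 20 := Nat.mul_le_mul h2 h2
    nlinarith
  · have hkn : k < n := by
      have h1 := Nat.choose_two_right n
      have h2 : n * (n - 1) ≤ n * n := Nat.mul_le_mul_left _ (Nat.sub_le _ _)
      by_contra hcon
      push Not at hcon
      have h3 : n * n ≤ k * k := Nat.mul_le_mul hcon hcon
      have h4 : 0 < k * k := by have : 0 < k := by omega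
                                positivity
      omega
    obtain ⟨es, hes, hE⟩ := exists_bad_sequence (n := n) hpos (by omega)
    obtain ⟨hnd, hdiag⟩ := hE.nodup isDFSForest_bot
    have h20 : 20 * N ≤ k := Nat.mul_div_le k 20
    have h21 : k + 1 ≤ 40 * N := by omega
    have h1 : 20 * N * (20 * N) ≤ k * k := Nat.mul_le_mul h20 h20
    have h2 : (k + 1) * (k + 1) ≤ 40 * N * (40 * N) := Nat.mul_le_mul h21 h21
    obtain ⟨fs, hfs⟩ := exists_insertionSeq_append hnd (fun e he => (hdiag e he).2)
      (by nlinarith) hm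
    refine ⟨es ++ fs, hfs, fun t ht => ?_⟩
    have h3 : N ^ 4 ≤ t := hE.le_of_run ht
    have h4 : m ≤ 1600 * N ^ 2 := by nlinarith
    calc m ^ 2 ≤ (1600 * N ^ 2) ^ 2 := Nat.pow_le_pow_left h4 2
      _ = 2560000 * N ^ 4 := by ring
      _ ≤ 2560000 * t := Nat.mul_le_mul_left _ h3

end IncDFS

theorem mainTheorem11 :
    ∃ a b c : ℝ, 0 < a ∧ 0 < b ∧ 0 < c ∧
      ∀ n m : ℕ, n ≤ m → m ≤ n.choose 2 →
        ∃ es : List (Sym2 (Fin n)), IncDFS.IsInsertionSeq m es ∧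
          (∃ t : ℕ, IncDFS.SDFS3Takes es t) ∧
          ∀ t : ℕ, IncDFS.SDFS3Takes es t →
            a * (m : ℝ) ^ 2 ≤ (t : ℝ) ∧ (t : ℝ) ≤ b * (m : ℝ) ^ 2 ∧
            ∀ es' : List (Sym2 (Fin n)), IncDFS.IsInsertionSeq m es' →
              (∃ t' : ℕ, IncDFS.SDFSTakes es' t') ∧
              ∀ t' : ℕ, IncDFS.SDFSTakes es' t' → (t' : ℝ) ≤ c * (t : ℝ) := by
  -- By `n ≤ m`, the time bounds `m(2 + 4n + 2m)` for SDFS3 and `m(1 + 2n + 2m)` for SDFS are at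
  -- most `8m^2` and `5m^2`.
  refine ⟨1 / 2560000, 8, 5 * 2560000, by norm_num, by norm_num, by norm_num, fun n m hnm hm => ?_⟩
  obtain ⟨es, hes, hlow⟩ := IncDFS.exists_insertionSeq hm
  refine ⟨es, hes, IncDFS.SDFS3Run.exists IncDFS.isDFSForest_bot es, fun t ht => ?_⟩
  have hl := hlow t ht
  have hl' : (m : ℝ) ^ 2 ≤ 2560000 * t := by exact_mod_cast hl
  have hmm : m ≤ m ^ 2 := Nat.le_self_pow two_ne_zero m
  have hmn : m * n ≤ m ^ 2 := sq m ▸ Nat.mul_le_mul_left m hnm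
  refine ⟨by linarith, ?_, fun es' hes' => ⟨IncDFS.SDFSRun.exists ⊥ es', fun t' ht' => ?_⟩⟩
  · have h := IncDFS.SDFS3Run.time_le ht
    rw [hes.1, SimpleGraph.edgeSet_bot, Set.ncard_empty, Fintype.card_fin] at h
    have h2 : t ≤ 8 * m ^ 2 := by nlinarith
    exact_mod_cast h2
  · have h := IncDFS.SDFSRun.time_le ht'
    rw [hes'.1, SimpleGraph.edgeSet_bot, Set.ncard_empty, Fintype.card_fin] at h
    have h2 : t' ≤ 5 * m ^ 2 := by nlinarith
    have h3 : (t' : ℝ) ≤ 5 * (m : ℝ) ^ 2 := by exact_mod_cast h2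
    linarith
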